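/- Let $d\ge 1$, let $\lambda>0$ and $\mu_1,\dots,\mu_d$ be real numbers with $\lambda+\sum_{i=1}^d\mu_i=1$, and assume stability: $\lambda<\mu_i$ for all $i$. Let $I_1,I_2,\dots$ be i.i.d. with $\mathbb P(I_k=e_1)=\lambda$, $\mathbb P(I_k=-e_i+e_{i+1})=\mu_i$ for $1\le i\le d-1$, and $\mathbb P(I_k=-e_d)=\mu_d$. Let $X$ be the constrained random walk on $\mathbb Z_+^d$ given by $X_{k+1}=X_k+I_{k+1}$ if $X_k+I_{k+1}\in\mathbb Z_+^d$ and $X_{k+1}=X_k$ otherwise, and let $\tau_n=\inf\{k\ge 0: X_k\in\mathbb Z_+^d,\ \sum_{i=1}^d X_k(i)=n\}$. For $v\in\mathbb Z^d$ let $\mathcal I_1 v=(-v(1),v(2),\dots,v(d))$, and let $T_n(x)=(n-x(1),x(2),\dots,x(d))$. Let $Y$ be the walk on $\mathbb Z\times\mathbb Z_+^{d-1}$ given by $Y_{k+1}=Y_k+\mathcal I_1I_{k+1}$ if $Y_k+\mathcal I_1I_{k+1}\in\mathbb Z\times\mathbb Z_+^{d-1}$ and $Y_{k+1}=Y_k$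 otherwise, and let $\tau=\inf\{k\ge 0: Y_k(1)=\sum_{j=2}^d Y_k(j)\}$. Subscripts of $\mathbb P$ denote the initial point of the walk. Put $\rho_i=\lambda/\mu_i$, $\rho=\max_i\rho_i$ (so $0<\rho<1$), $A=\{x\in\mathbb R_+^d:\sum_{j=1}^d x(j)\le 1\}$, $$R_\rho=\bigcap_{i=1}^d\Big\{x\in\mathbb R_+^d:\ \sum_{j=1}^i x(j)\le 1-\frac{\log\rho}{\log\rho_i}\Big\},\qquad \bar R_{\rho,n}=\bigcup_{i=1}^d\Big\{x\in\mathbb Z_+^d:\ \sum_{j=1}^i x(j)\ge 1+n\Big(1-\frac{\log\rho}{\log\rho_i}\Big)\Big\},$$ $$g(x)=\min_{1\le i\le d}\Big(1-\sum_{j=1}^i x(j)\Big)\log_\rho\rho_i,\qquad x\in\mathbb R_+^d .$$ Then for every $\epsilon>0$ there is $n_0>0$ such that for all $n>n_0$ and all $x\in\bar R_{\rho,n}$ we have $\mathbb P_x(\tau_n<\tau_0)>0$ and $$\frac{\left|\mathbb P_x(\tau_n<\tau_0)-\mathbb P_{T_n(x)}(\tau<\infty)\right|}{\mathbb P_x(\tau_n<\tau_0)}\le\rho^{\,n(1-g(x/n)-\epsilon)}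 .$$ Consequently, if $x_n\in\mathbb Z_+^d$ and $x_n/n\to x\in A\setminus R_\rho$, then $-\log(\rho)\,(1-g(x))>0$, $\mathbb P_{x_n}(\tau_n<\tau_0)>0$ for all large $n$, and $$\liminf_{n\to\infty}\,-\frac1n\log\left(\frac{\left|\mathbb P_{x_n}(\tau_n<\tau_0)-\mathbb P_{T_n(x_n)}(\tau<\infty)\right|}{\mathbb P_{x_n}(\tau_n<\tau_0)}\right)\ge-\log(\rho)\,(1-g(x)),$$ where $\log 0=-\infty$. -/

import Mathlib

open MeasureTheory Filter Topology

namespace Tandem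

noncomputable section

/-! The nodes `1, …, d` are indexed by `Fin d`, so node `1` is `(0 : Fin d)`. -/

/-- The increment `e₁`: an arrival at the first node. -/
def arrival (d : ℕ) [NeZero d] : Fin d → ℤ := Pi.single 0 1

/-- The increment of a service completion at node `i`: `-e_i + e_{i+1}` if `i` is not the last
node, and `-e_d` if it is. -/
def service {d : ℕ} (i : Fin d) : Fin d → ℤ :=
  fun j => (if j = i then -1 else 0) + (if (j : ℕ) = (i : ℕ) + 1 then 1 else 0)

/-- The law of one increment `I_k`: mass `lam` at `e₁` and mass `mu i` at `service i`. -/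
def incrementLaw {d : ℕ} [NeZero d] (lam : ℝ) (mu : Fin d → ℝ) : Measure (Fin d → ℤ) :=
  ENNReal.ofReal lam • Measure.dirac (arrival d) +
    ∑ i, ENNReal.ofReal (mu i) • Measure.dirac (service i)

/-- The law of the i.i.d. sequence of increments; the entry `v k` is the increment `I_{k+1}`. -/
def pathLaw {d : ℕ} [NeZero d] (lam : ℝ) (mu : Fin d → ℝ) : Measure (ℕ → Fin d → ℤ) :=
  Measure.infinitePi fun _ => incrementLaw lam mu

theorem isProbabilityMeasure_incrementLaw {d : ℕ} [NeZero d] {lam : ℝ} {mu : Fin d → ℝ}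
    (hlam : 0 < lam) (hmu : ∀ i, lam < mu i) (hsum : lam + ∑ i, mu i = 1) :
    IsProbabilityMeasure (incrementLaw lam mu) := by
  constructor
  have h : ∀ i ∈ Finset.univ, 0 ≤ mu i := fun i _ => (hlam.trans (hmu i)).le
  simp only [incrementLaw, Measure.add_apply, Measure.smul_apply, Measure.finsetSum_apply,
    measure_univ, smul_eq_mul, mul_one]
  rw [← ENNReal.ofReal_sum_of_nonneg h, ← ENNReal.ofReal_add hlam.le (Finset.sum_nonneg h),
    hsum, ENNReal.ofReal_one]

theorem isProbabilityMeasure_pathLaw {d : ℕ} [NeZero d] {lam : ℝ} {mu : Fin d → ℝ}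
    (hlam : 0 < lam) (hmu : ∀ i, lam < mu i) (hsum : lam + ∑ i, mu i = 1) :
    IsProbabilityMeasure (pathLaw lam mu) := by
  have := isProbabilityMeasure_incrementLaw hlam hmu hsum
  unfold pathLaw
  infer_instance

open scoped Classical in
/-- The constrained increment `π(x, v)`: `v` if `x + v ∈ ℤ₊^d`, and `0` otherwise. -/
def constrain {d : ℕ} (x v : Fin d → ℤ) : Fin d → ℤ :=
  if ∀ i, 0 ≤ x i + v i then v else 0

open scoped Classical in
/-- The constrained increment `π₁(y, v)`: `v` if `y + v ∈ ℤ × ℤ₊^{d-1}`, and `0` otherwise. -/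
def constrain₁ {d : ℕ} [NeZero d] (y v : Fin d → ℤ) : Fin d → ℤ :=
  if ∀ i, i ≠ 0 → 0 ≤ y i + v i then v else 0

/-- The linear map `𝓘₁`, changing the sign of the first coordinate. -/
def reflect {d : ℕ} [NeZero d] (v : Fin d → ℤ) : Fin d → ℤ :=
  fun i => if i = 0 then -v i else v i

/-- The affine map `T_n(x) = n e₁ + 𝓘₁ x = (n - x(1), x(2), …, x(d))`. -/
def T {d : ℕ} [NeZero d] (n : ℕ) (x : Fin d → ℤ) : Fin d → ℤ :=
  Pi.single 0 (n : ℤ) + reflect x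

/-- The constrained walk `X` started at `x` and driven by the increments `v`. -/
def X {d : ℕ} (x : Fin d → ℤ) : ℕ → (ℕ → Fin d → ℤ) → Fin d → ℤ
  | 0, _ => x
  | k + 1, v => X x k v + constrain (X x k v) (v k)

/-- The limit walk `Y` started at `y` and driven by the increments `J_k = 𝓘₁ I_k`. -/
def Y {d : ℕ} [NeZero d] (y : Fin d → ℤ) : ℕ → (ℕ → Fin d → ℤ) → Fin d → ℤ
  | 0, _ => y
  | k + 1, v => Y y k v + constrain₁ (Y y k v) (reflect (v k))

/-- The exit boundary `∂A_n = {x ∈ ℤ₊^d : ∑ x(i) = n}`. -/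
def boundaryA (d n : ℕ) : Set (Fin d → ℤ) :=
  {x | (∀ i, 0 ≤ x i) ∧ ∑ i, x i = n}

/-- The boundary `∂B = {y ∈ ℤ × ℤ₊^{d-1} : y(1) = ∑_{j ≥ 2} y(j)}`. -/
def boundaryB (d : ℕ) [NeZero d] : Set (Fin d → ℤ) :=
  {y | (∀ i, i ≠ 0 → 0 ≤ y i) ∧ y 0 = ∑ j ∈ Finset.univ.erase 0, y j}

/-- `τ_n = inf {k ≥ 0 : X_k ∈ ∂A_n}` for the walk `X` started at `x` (`⊤` if there is none). -/
def tauX {d : ℕ} (x : Fin d → ℤ) (n : ℕ) : (ℕ → Fin d → ℤ) → WithTop ℕ :=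
  hittingAfter (X x) (boundaryA d n) 0

/-- `τ = inf {k ≥ 0 : Y_k ∈ ∂B}` for the walk `Y` started at `y` (`⊤` if there is none). -/
def tauY {d : ℕ} [NeZero d] (y : Fin d → ℤ) : (ℕ → Fin d → ℤ) → WithTop ℕ :=
  hittingAfter (Y y) (boundaryB d) 0

/-- The probability `ℙ_x(τ_n < τ_0)`. -/
def probX {d : ℕ} [NeZero d] (lam : ℝ) (mu : Fin d → ℝ) (n : ℕ) (x : Fin d → ℤ) : ℝ :=
  (pathLaw lam mu).real {v | tauX x n v < tauX x 0 v}

/-- The probability `ℙ_y(τ < ∞)`. -/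
def probY {d : ℕ} [NeZero d] (lam : ℝ) (mu : Fin d → ℝ) (y : Fin d → ℤ) : ℝ :=
  (pathLaw lam mu).real {v | tauY y v < ⊤}

/-- The relative error of the approximation of `ℙ_x(τ_n < τ_0)` by `ℙ_{T_n(x)}(τ < ∞)`. -/
def relErr {d : ℕ} [NeZero d] (lam : ℝ) (mu : Fin d → ℝ) (n : ℕ) (x : Fin d → ℤ) : ℝ :=
  |probX lam mu n x - probY lam mu (T n x)| / probX lam mu n x

/-- The utilization `ρ_i = λ / μ_i` of node `i`. -/
def rhoAt {d : ℕ} (lam : ℝ) (mu : Fin d → ℝ) (i : Fin d) : ℝ := lam / mu i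

/-- `ρ = max_i ρ_i`. -/
def rho {d : ℕ} (lam : ℝ) (mu : Fin d → ℝ) : ℝ := ⨆ i, rhoAt lam mu i

/-- The simplex `A = {x ∈ ℝ₊^d : ∑ x(i) ≤ 1}`. -/
def simplexA (d : ℕ) : Set (Fin d → ℝ) :=
  {x | (∀ i, 0 ≤ x i) ∧ ∑ i, x i ≤ 1}

/-- The region `R_ρ`. -/
def R {d : ℕ} (lam : ℝ) (mu : Fin d → ℝ) : Set (Fin d → ℝ) :=
  {x | (∀ i, 0 ≤ x i) ∧
    ∀ i, ∑ j ∈ Finset.Iic i, x j ≤ 1 - Real.log (rho lam mu) / Real.log (rhoAt lam mu i)}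

/-- The region `R̄_{ρ,n}`. -/
def Rbar {d : ℕ} (lam : ℝ) (mu : Fin d → ℝ) (n : ℕ) : Set (Fin d → ℤ) :=
  {x | (∀ i, 0 ≤ x i) ∧
    ∃ i, 1 + (n : ℝ) * (1 - Real.log (rho lam mu) / Real.log (rhoAt lam mu i)) ≤
      ∑ j ∈ Finset.Iic i, (x j : ℝ)}

/-- `g(x) = min_i (1 - ∑_{j ≤ i} x(j)) log_ρ ρ_i`. -/
def g {d : ℕ} (lam : ℝ) (mu : Fin d → ℝ) (x : Fin d → ℝ) : ℝ :=
  ⨅ i, (1 - ∑ j ∈ Finset.Iic i, x j) * Real.logb (rho lam mu) (rhoAt lam mu i)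

end

end Tandem

/-! Drive `X` and `freeX`, the pull-back of `Y` under `T n`, by the same increments. `freeX` lacks
the constraint at the first node, and τ < ∞ says that its total reaches n. Write S_j for the partial
sum x(1) + ⋯ + x(j).

Upper bound on the absolute error. The partial sums of `freeX` never exceed those of `X`
(`IsCoupled.step`), and the totals can differ only after `X` has found nodes 1, …, d empty at
successive times, in this order (`IsCoupled.step_eq`). For any r in (ρ, 1), reaching total n after
that costs about r^n whatever the starting point. Indeed r^{-S_j} decreases in mean while node j can
serve, and when node j is empty S_j = S_{j-1}, so the bound passes from one node to the next. The
function `lyapunov` carries this through the d stages, starting from the value 1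
(`pathLaw_hit_sdiff_le`). The bounded drift left over is paid for by a function V with drift at most
-1 off the origin, which grows only like r₀^{-n} with r₀ close to 1 (`exists_drift_le_neg_one`).
Conversely, if `freeX` reaches n and `X` does not do so before the origin, then `X` visits the
origin first; all partial sums of `freeX` are then at most 0, and a supermartingale bound gives r^n
again (`pathLaw_free_sdiff_le`).

Lower bound on the probability. With r = ρ_i, r^{-S_i} is a submartingale for `X`, so the
probability is at least ρ_i^n (ρ_i^{-S_i} - 1) for every i (`le_probX`). The best i gives (1 - ρ)
ρ^{n g(x/n)} on `Rbar` (`rho_rpow_le_probX`). Dividing the two bounds yields the rate. -/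

namespace Tandem

noncomputable section

/-! ### First step analysis and supermartingale bounds for reaching probabilities. -/

section FirstStep

/-- The sequence `e, v 0, v 1, …`. -/
def consSeq {α : Type*} (e : α) (v : ℕ → α) : ℕ → α
  | 0 => e
  | k + 1 => v k

theorem measurable_consSeq {α : Type*} [MeasurableSpace α] :
    Measurable fun p : α × (ℕ → α) => consSeq p.1 p.2 := by
  refine measurable_pi_lambda _ fun k => ?_
  cases k with
  | zero => exact measurable_fst
  | succ k => exact (measurable_pi_apply k).comp measurable_snd

/-- It suffices to compare measures of boxes. A box over a finite index set is padded by whole-space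
factors to an initial segment, from which coordinate 0 splits off. -/
theorem map_consSeq_prod_infinitePi {α : Type*} [MeasurableSpace α] (ν : Measure α)
    [IsProbabilityMeasure ν] :
    (ν.prod (Measure.infinitePi fun _ : ℕ => ν)).map (fun p => consSeq p.1 p.2) =
      Measure.infinitePi fun _ : ℕ => ν := by
  classical
  refine Measure.eq_infinitePi _ fun s t ht => ?_
  obtain ⟨N, hN⟩ : ∃ N, s ⊆ Finset.range (N + 1) :=
    ⟨s.sup id, fun i hi => Finset.mem_range_succ_iff.2 (Finset.le_sup (f := id) hi)⟩
  set t' : ℕ → Set α := fun i => if i ∈ s then t i else Set.univ with ht'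
  have hmeas : ∀ i, MeasurableSet (t' i) := by
    intro i
    simp only [ht']
    split_ifs
    exacts [ht i, MeasurableSet.univ]
  have hpi : Set.pi (s : Set ℕ) t = Set.pi (Finset.range (N + 1) : Set ℕ) t' := by
    ext v
    simp only [Set.mem_pi, Finset.mem_coe, ht']
    constructor
    · intro h i _
      split_ifs with his
      exacts [h i his, Set.mem_univ _]
    · intro h i hi
      have := h i (hN hi)
      rwa [if_pos hi] at this
  have hprod : ∏ i ∈ s, ν (t i) = ∏ i ∈ Finset.range (N + 1), ν (t' i) := by
    rw [← Finset.prod_subset hN]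
    · refine Finset.prod_congr rfl fun i hi => ?_
      simp only [ht', if_pos hi]
    · intro i _ hi
      simp only [ht', if_neg hi, measure_univ]
  have hpre : (fun p : α × (ℕ → α) => consSeq p.1 p.2) ⁻¹'
      Set.pi (Finset.range (N + 1) : Set ℕ) t' =
      t' 0 ×ˢ Set.pi (Finset.range N : Set ℕ) (fun i => t' (i + 1)) := by
    ext p
    simp only [Set.mem_preimage, Set.mem_pi, Finset.mem_coe, Finset.mem_range, Set.mem_prod]
    constructor
    · exact fun h => ⟨h 0 (by omega), fun i hi => h (i + 1) (by omega)⟩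
    · rintro ⟨h0, h1⟩ (_ | i) hi
      exacts [h0, h1 i (by omega)]
  have hbox : MeasurableSet (Set.pi (Finset.range (N + 1) : Set ℕ) t') :=
    MeasurableSet.pi (Finset.countable_toSet _) fun i _ => hmeas i
  rw [hpi, Measure.map_apply measurable_consSeq hbox, hpre, Measure.prod_prod,
    Measure.infinitePi_pi (μ := fun _ : ℕ => ν) (fun i _ => hmeas (i + 1)), hprod,
    Finset.prod_range_succ', mul_comm]

variable {d : ℕ}

/-- The Markov chain with transition `s ↦ f s e` upon the increment `e`. -/
def run {S : Type*} (f : S → (Fin d → ℤ) → S) (s : S) : ℕ → (ℕ → Fin d → ℤ) → S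
  | 0, _ => s
  | k + 1, v => f (run f s k v) (v k)

theorem run_shift {S : Type*} (f : S → (Fin d → ℤ) → S) (s : S) (k : ℕ)
    (v : ℕ → Fin d → ℤ) :
    run f s (k + 1) v = run f (f s (v 0)) k (fun j => v (j + 1)) := by
  induction k with
  | zero => rfl
  | succ k ih => rw [run, ih, run]

variable [NeZero d]

/-- The increments charged by `incrementLaw`. -/
def Jump (e : Fin d → ℤ) : Prop := e = arrival d ∨ ∃ i, e = service i

/-- The mean of `φ` under `incrementLaw`. -/
def mean (lam : ℝ) (mu : Fin d → ℝ) (φ : (Fin d → ℤ) → ℝ) : ℝ :=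
  lam * φ (arrival d) + ∑ i, mu i * φ (service i)

theorem mean_const {lam : ℝ} {mu : Fin d → ℝ} (hsum : lam + ∑ i, mu i = 1) (c : ℝ) :
    mean lam mu (fun _ => c) = c := by
  rw [mean, ← Finset.sum_mul, ← add_mul, hsum, one_mul]

theorem mean_add (lam : ℝ) (mu : Fin d → ℝ) (φ ψ : (Fin d → ℤ) → ℝ) :
    mean lam mu (fun e => φ e + ψ e) = mean lam mu φ + mean lam mu ψ := by
  simp only [mean, mul_add, Finset.sum_add_distrib]
  ring

theorem mean_const_mul (lam : ℝ) (mu : Fin d → ℝ) (c : ℝ) (φ : (Fin d → ℤ) → ℝ) :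
    mean lam mu (fun e => c * φ e) = c * mean lam mu φ := by
  simp only [mean, mul_add, Finset.mul_sum]
  congr 1
  · ring
  · exact Finset.sum_congr rfl fun i _ => by ring

theorem mean_sub_eq {lam : ℝ} {mu : Fin d → ℝ} (hsum : lam + ∑ i, mu i = 1)
    (φ : (Fin d → ℤ) → ℝ) (c : ℝ) :
    mean lam mu φ - c = lam * (φ (arrival d) - c) + ∑ i, mu i * (φ (service i) - c) := by
  have h := mean_const hsum c
  simp only [mean] at h ⊢
  simp only [mul_sub, Finset.sum_sub_distrib]
  linarith

theorem lintegral_incrementLaw (lam : ℝ) (mu : Fin d → ℝ) (φ : (Fin d → ℤ) → ENNReal) :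
    ∫⁻ e, φ e ∂incrementLaw lam mu =
      ENNReal.ofReal lam * φ (arrival d) + ∑ i, ENNReal.ofReal (mu i) * φ (service i) := by
  simp [incrementLaw, lintegral_add_measure, lintegral_finsetSum_measure, lintegral_smul_measure]

theorem ae_jump {lam : ℝ} {mu : Fin d → ℝ} (hlam : 0 < lam) (hmu : ∀ i, lam < mu i)
    (hsum : lam + ∑ i, mu i = 1) : ∀ᵐ v ∂pathLaw lam mu, ∀ k, Jump (v k) := by
  have := isProbabilityMeasure_incrementLaw hlam hmu hsum
  rw [ae_all_iff]
  intro k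
  have h : ∀ᵐ e ∂incrementLaw lam mu, Jump e := by
    have h0 : (incrementLaw lam mu) {e | ¬ Jump e} = 0 := by
      have h1 : ¬ (arrival d ∈ {e : Fin d → ℤ | ¬ Jump e}) := fun h => h (Or.inl rfl)
      have h2 : ∀ i, ¬ (service i ∈ {e : Fin d → ℤ | ¬ Jump e}) := fun i h => h (Or.inr ⟨i, rfl⟩)
      simp [incrementLaw, Measure.dirac_apply, Set.indicator_of_notMem h1,
        Set.indicator_of_notMem (h2 _)]
    exact h0
  exact (measurePreserving_eval_infinitePi
    (fun _ : ℕ => incrementLaw lam mu) k).quasiMeasurePreserving.ae h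

/-- First step analysis, as an inequality valid for arbitrary sets. -/
theorem pathLaw_le_firstStep {lam : ℝ} {mu : Fin d → ℝ} (hlam : 0 < lam) (hmu : ∀ i, lam < mu i)
    (hsum : lam + ∑ i, mu i = 1) (B : (Fin d → ℤ) → Set (ℕ → Fin d → ℤ)) :
    pathLaw lam mu {v | (fun k => v (k + 1)) ∈ B (v 0)} ≤
      ENNReal.ofReal lam * pathLaw lam mu (B (arrival d)) +
        ∑ i, ENNReal.ofReal (mu i) * pathLaw lam mu (B (service i)) := by
  have := isProbabilityMeasure_incrementLaw hlam hmu hsum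
  have := isProbabilityMeasure_pathLaw hlam hmu hsum
  set P := pathLaw lam mu with hP
  -- Replacing each section by a measurable hull keeps its measure, so the inequality needs no
  -- measurability of `B`.
  set M : Set ((Fin d → ℤ) × (ℕ → Fin d → ℤ)) := ⋃ e, {e} ×ˢ toMeasurable P (B e) with hM
  have hMm : MeasurableSet M :=
    MeasurableSet.iUnion fun e => (measurableSet_singleton e).prod (measurableSet_toMeasurable _ _)
  have hsplit : Measurable fun v : ℕ → Fin d → ℤ => (v 0, fun k => v (k + 1)) :=
    (measurable_pi_apply 0).prodMk (measurable_pi_lambda _ fun k => measurable_pi_apply _)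
  have hsub : {v | (fun k => v (k + 1)) ∈ B (v 0)} ⊆
      (fun v : ℕ → Fin d → ℤ => (v 0, fun k => v (k + 1))) ⁻¹' M := by
    intro v hv
    exact Set.mem_iUnion.2 ⟨v 0, rfl, subset_toMeasurable _ _ hv⟩
  refine (measure_mono hsub).trans ?_
  have hmap : P = ((incrementLaw lam mu).prod P).map (fun p => consSeq p.1 p.2) :=
    (map_consSeq_prod_infinitePi _).symm
  rw [hmap, Measure.map_apply measurable_consSeq (hsplit hMm), ← hmap]
  have hid : (fun p : (Fin d → ℤ) × (ℕ → Fin d → ℤ) => consSeq p.1 p.2) ⁻¹'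
      ((fun v : ℕ → Fin d → ℤ => (v 0, fun k => v (k + 1))) ⁻¹' M) = M := rfl
  rw [hid, Measure.prod_apply hMm]
  have hsec : ∀ e, Prod.mk e ⁻¹' M = toMeasurable P (B e) := by
    intro e
    ext v
    simp [hM]
  simp only [hsec, measure_toMeasurable]
  rw [lintegral_incrementLaw]

theorem run_mem {S : Type*} {f : S → (Fin d → ℤ) → S} {I : Set S}
    (hI : ∀ s ∈ I, ∀ e, Jump e → f s e ∈ I) {s : S} (hs : s ∈ I) {v : ℕ → Fin d → ℤ}
    (hv : ∀ k, Jump (v k)) (k : ℕ) : run f s k v ∈ I := by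
  induction k with
  | zero => exact hs
  | succ k ih => exact hI _ ih _ (hv k)

/-- A nonnegative function which is at least `1` on `G` and superharmonic on `A` bounds the
probability of reaching `G` through `A`. -/
theorem pathLaw_reach_le {lam : ℝ} {mu : Fin d → ℝ} (hlam : 0 < lam) (hmu : ∀ i, lam < mu i)
    (hsum : lam + ∑ i, mu i = 1) {S : Type*} (f : S → (Fin d → ℤ) → S) (I G A : Set S)
    (h : S → ℝ) (hpos : ∀ s ∈ I, 0 ≤ h s) (hG : ∀ s ∈ I, s ∈ G → 1 ≤ h s)
    (hI : ∀ s ∈ I, s ∈ A → ∀ e, Jump e → f s e ∈ I)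
    (hsuper : ∀ s ∈ I, s ∈ A → mean lam mu (fun e => h (f s e)) ≤ h s) {s : S} (hs : s ∈ I) :
    pathLaw lam mu {v | ∃ k, run f s k v ∈ G ∧ ∀ i < k, run f s i v ∈ A} ≤
      ENNReal.ofReal (h s) := by
  have := isProbabilityMeasure_pathLaw hlam hmu hsum
  -- Induction on the time horizon, with first step analysis as the induction step; continuity from
  -- below then removes the horizon.
  have key : ∀ N : ℕ, ∀ s ∈ I,
      pathLaw lam mu {v | ∃ k ≤ N, run f s k v ∈ G ∧ ∀ i < k, run f s i v ∈ A} ≤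
        ENNReal.ofReal (h s) := by
    intro N
    induction N with
    | zero =>
      intro s hs
      by_cases hg : s ∈ G
      · exact prob_le_one.trans (ENNReal.one_le_ofReal.2 (hG s hs hg))
      · refine (measure_mono_null ?_ measure_empty).trans_le zero_le
        rintro v ⟨k, hk, hkG, -⟩
        obtain rfl : k = 0 := by omega
        exact hg hkG
    | succ N ih =>
      intro s hs
      by_cases hg : s ∈ G
      · exact prob_le_one.trans (ENNReal.one_le_ofReal.2 (hG s hs hg))
      by_cases ha : s ∈ A
      swap
      · refine (measure_mono_null ?_ measure_empty).trans_le zero_le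
        rintro v ⟨k, hk, hkG, hkA⟩
        cases k with
        | zero => exact hg hkG
        | succ k => exact ha (hkA 0 (by omega))
      set B : (Fin d → ℤ) → Set (ℕ → Fin d → ℤ) := fun e =>
        {v | ∃ k ≤ N, run f (f s e) k v ∈ G ∧ ∀ i < k, run f (f s e) i v ∈ A} with hB
      have hsub : {v | ∃ k ≤ N + 1, run f s k v ∈ G ∧ ∀ i < k, run f s i v ∈ A} ⊆
          {v | (fun k => v (k + 1)) ∈ B (v 0)} := by
        rintro v ⟨k, hk, hkG, hkA⟩
        cases k with
        | zero => exact absurd hkG hg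
        | succ k =>
          refine ⟨k, by omega, ?_, fun i hi => ?_⟩
          · rwa [← run_shift]
          · rw [← run_shift]
            exact hkA (i + 1) (by omega)
      refine (measure_mono hsub).trans
        ((pathLaw_le_firstStep hlam hmu hsum B).trans ?_)
      have hb : ∀ e, Jump e → pathLaw lam mu (B e) ≤ ENNReal.ofReal (h (f s e)) :=
        fun e he => ih _ (hI s hs ha e he)
      have hn : ∀ e, Jump e → 0 ≤ h (f s e) := fun e he => hpos _ (hI s hs ha e he)
      have hmu0 : ∀ i, 0 ≤ mu i := fun i => (hlam.trans (hmu i)).le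
      calc _ ≤ ENNReal.ofReal lam * ENNReal.ofReal (h (f s (arrival d))) +
            ∑ i, ENNReal.ofReal (mu i) * ENNReal.ofReal (h (f s (service i))) := by
            gcongr with i
            · exact hb _ (Or.inl rfl)
            · exact hb _ (Or.inr ⟨i, rfl⟩)
        _ = ENNReal.ofReal (mean lam mu fun e => h (f s e)) := by
            rw [mean, ENNReal.ofReal_add, ENNReal.ofReal_mul hlam.le,
              ENNReal.ofReal_sum_of_nonneg]
            · simp only [ENNReal.ofReal_mul (hmu0 _)]
            · exact fun i _ => mul_nonneg (hmu0 i) (hn _ (Or.inr ⟨i, rfl⟩))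
            · exact mul_nonneg hlam.le (hn _ (Or.inl rfl))
            · exact Finset.sum_nonneg fun i _ => mul_nonneg (hmu0 i) (hn _ (Or.inr ⟨i, rfl⟩))
        _ ≤ _ := ENNReal.ofReal_le_ofReal (hsuper s hs ha)
  have hU : {v | ∃ k, run f s k v ∈ G ∧ ∀ i < k, run f s i v ∈ A} =
      ⋃ N : ℕ, {v | ∃ k ≤ N, run f s k v ∈ G ∧ ∀ i < k, run f s i v ∈ A} := by
    ext v
    simp only [Set.mem_ofPred_eq, Set.mem_iUnion]
    exact ⟨fun ⟨k, hk⟩ => ⟨k, k, le_rfl, hk⟩, fun ⟨_, k, _, hk⟩ => ⟨k, hk⟩⟩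
  have hmono : Monotone fun N : ℕ =>
      {v | ∃ k ≤ N, run f s k v ∈ G ∧ ∀ i < k, run f s i v ∈ A} :=
    fun M N hMN v ⟨k, hk, hk'⟩ => ⟨k, hk.trans hMN, hk'⟩
  rw [hU, hmono.measure_iUnion]
  exact iSup_le fun N => key N s hs

end FirstStep

/-! ### Partial sums of the coordinates, each lowered by the service at exactly one node. -/

/-- The partial sum `x(1) + ⋯ + x(j)`. -/
def partialSum {d : ℕ} (x : Fin d → ℤ) (j : ℕ) : ℤ := ∑ k : Fin d, if (k : ℕ) < j then x k else 0

section PartialSum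

variable {d : ℕ}

@[simp] theorem partialSum_zero (x : Fin d → ℤ) : partialSum x 0 = 0 := by
  simp [partialSum]

@[simp] theorem partialSum_zero_left (j : ℕ) : partialSum (0 : Fin d → ℤ) j = 0 := by
  simp [partialSum]

theorem partialSum_add (x y : Fin d → ℤ) (j : ℕ) :
    partialSum (x + y) j = partialSum x j + partialSum y j := by
  simp only [partialSum, ← Finset.sum_add_distrib]
  refine Finset.sum_congr rfl fun k _ => ?_
  split_ifs <;> simp

theorem partialSum_succ (x : Fin d → ℤ) (i : Fin d) :
    partialSum x ((i : ℕ) + 1) = partialSum x i + x i := by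
  have h : x i = ∑ k : Fin d, if k = i then x k else 0 := by simp
  rw [partialSum, partialSum, h, ← Finset.sum_add_distrib]
  refine Finset.sum_congr rfl fun k _ => ?_
  by_cases hk : k = i
  · subst hk; simp
  · have : (k : ℕ) ≠ i := fun h => hk (Fin.ext h)
    simp only [hk, if_false, add_zero]
    congr 1
    exact propext ⟨fun h => by omega, fun h => by omega⟩

theorem partialSum_top (x : Fin d → ℤ) : partialSum x d = ∑ k, x k := by
  simp [partialSum]

theorem partialSum_succ_eq_sum_Iic (x : Fin d → ℤ) (i : Fin d) :
    partialSum x ((i : ℕ) + 1) = ∑ k ∈ Finset.Iic i, x k := by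
  rw [partialSum, ← Finset.sum_filter]
  refine Finset.sum_congr ?_ fun _ _ => rfl
  ext k
  simp only [Finset.mem_filter, Finset.mem_univ, true_and, Finset.mem_Iic, Fin.le_def]
  omega

theorem partialSum_mono {x : Fin d → ℤ} (hx : ∀ i, 0 ≤ x i) : Monotone (partialSum x) := by
  intro a b hab
  refine Finset.sum_le_sum fun k _ => ?_
  split_ifs
  · exact le_rfl
  · omega
  · exact hx k
  · exact le_rfl

theorem partialSum_nonneg {x : Fin d → ℤ} (hx : ∀ i, 0 ≤ x i) (j : ℕ) : 0 ≤ partialSum x j := by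
  rw [← partialSum_zero x]
  exact partialSum_mono hx (Nat.zero_le j)

theorem eq_zero_iff_partialSum {x : Fin d → ℤ} (hx : ∀ i, 0 ≤ x i) :
    x = 0 ↔ partialSum x d = 0 := by
  rw [partialSum_top, Finset.sum_eq_zero_iff_of_nonneg fun i _ => hx i]
  exact ⟨fun h => by simp [h], fun h => funext fun i => h i (Finset.mem_univ i)⟩

theorem exists_pos_of_ne_zero {x : Fin d → ℤ} (hx : ∀ i, 0 ≤ x i) (h : x ≠ 0) : ∃ i, 0 < x i := by
  by_contra! hc
  exact h (funext fun i => le_antisymm (hc i) (hx i))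

theorem partialSum_arrival [NeZero d] {j : ℕ} (hj : 1 ≤ j) : partialSum (arrival d) j = 1 := by
  rw [partialSum, Finset.sum_eq_single 0]
  · rw [if_pos (by simpa using Nat.lt_of_succ_le hj)]
    simp [arrival]
  · intro k _ hk
    simp [arrival, hk]
  · simp

theorem partialSum_service (i : Fin d) {j : ℕ} (hj : j ≤ d) :
    partialSum (service i) j = if j = (i : ℕ) + 1 then -1 else 0 := by
  induction j with
  | zero => simp
  | succ j ih =>
    rw [partialSum_succ (service i) ⟨j, hj⟩, ih (by omega)]
    simp only [service, Fin.ext_iff]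
    split_ifs <;> omega

theorem partialSum_jump_top [NeZero d] {e : Fin d → ℤ} (he : Jump e) :
    partialSum e d = 1 ∨ partialSum e d = 0 ∨ partialSum e d = -1 := by
  rcases he with rfl | ⟨i, rfl⟩
  · exact Or.inl (partialSum_arrival (Nat.pos_of_ne_zero (NeZero.ne d)))
  · rw [partialSum_service i le_rfl]
    split_ifs <;> simp

end PartialSum

/-! ### Which increments the two constraints accept. -/

section Step

variable {d : ℕ}

theorem add_constrain_nonneg {x : Fin d → ℤ} (hx : ∀ i, 0 ≤ x i) (e : Fin d → ℤ) (i : Fin d) :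
    0 ≤ (x + constrain x e) i := by
  unfold constrain
  split_ifs with h
  · exact h i
  · simpa using hx i

theorem constrain_arrival [NeZero d] {x : Fin d → ℤ} (hx : ∀ i, 0 ≤ x i) :
    constrain x (arrival d) = arrival d := by
  refine if_pos fun i => add_nonneg (hx i) ?_
  by_cases h : i = 0
  · subst h; simp [arrival]
  · simp [arrival, h]

theorem constrain_service {x : Fin d → ℤ} (hx : ∀ i, 0 ≤ x i) (i : Fin d) :
    constrain x (service i) = if 0 < x i then service i else 0 := by
  have h : (∀ j, 0 ≤ x j + service i j) ↔ 0 < x i := by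
    constructor
    · intro h
      have := h i
      simp [service] at this
      omega
    · intro h j
      have := hx j
      simp only [service]
      by_cases hj : j = i
      · subst hj; simp; omega
      · simp only [hj, if_false]
        split_ifs <;> omega
  simp only [constrain, h]

theorem add_constrain₁_nonneg [NeZero d] {x : Fin d → ℤ} (hx : ∀ i, i ≠ 0 → 0 ≤ x i)
    (e : Fin d → ℤ) (i : Fin d) (hi : i ≠ 0) : 0 ≤ (x + constrain₁ x e) i := by
  unfold constrain₁
  split_ifs with h
  · exact h i hi
  · simpa using hx i hi

theorem constrain₁_arrival [NeZero d] {x : Fin d → ℤ} (hx : ∀ i, i ≠ 0 → 0 ≤ x i) :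
    constrain₁ x (arrival d) = arrival d := by
  refine if_pos fun i hi => add_nonneg (hx i hi) ?_
  simp [arrival, hi]

theorem constrain₁_service [NeZero d] {x : Fin d → ℤ} (hx : ∀ i, i ≠ 0 → 0 ≤ x i) (i : Fin d) :
    constrain₁ x (service i) = if i = 0 ∨ 0 < x i then service i else 0 := by
  have h : (∀ j, j ≠ 0 → 0 ≤ x j + service i j) ↔ (i = 0 ∨ 0 < x i) := by
    constructor
    · intro h
      by_cases h0 : i = 0
      · exact Or.inl h0
      have := h i h0
      simp [service] at this
      omega
    · intro h j hj0
      have := hx j hj0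
      simp only [service]
      by_cases hj : j = i
      · subst hj; simp; simp only [hj0, false_or] at h; omega
      · simp only [hj, if_false]
        split_ifs <;> omega
  simp only [constrain₁, h]

/-- `D` is a law of motion at `x`: arrivals are accepted, and the service at a node is accepted
unless the node is empty. -/
structure IsMotion [NeZero d] (x : Fin d → ℤ) (D : (Fin d → ℤ) → Fin d → ℤ) : Prop where
  arrival : D (arrival d) = arrival d
  service : ∀ i, D (service i) = service i ∨ D (service i) = 0 ∧ x i = 0

theorem isMotion_constrain [NeZero d] {x : Fin d → ℤ} (hx : ∀ i, 0 ≤ x i) :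
    IsMotion x (constrain x) where
  arrival := constrain_arrival hx
  service i := by
    rw [constrain_service hx]
    by_cases h : 0 < x i
    · simp [h]
    · exact Or.inr ⟨if_neg h, le_antisymm (not_lt.1 h) (hx i)⟩

theorem isMotion_constrain₁ [NeZero d] {x : Fin d → ℤ} (hx : ∀ i, i ≠ 0 → 0 ≤ x i) :
    IsMotion x (constrain₁ x) where
  arrival := constrain₁_arrival hx
  service i := by
    rw [constrain₁_service hx]
    by_cases h : i = 0 ∨ 0 < x i
    · simp [h]
    · refine Or.inr ⟨if_neg h, ?_⟩
      push Not at h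
      exact le_antisymm h.2 (hx i h.1)

end Step

/-! ### Drift of the exponential Lyapunov function. -/

section Drift

variable {d : ℕ}

/-- The Lyapunov function `∑_{j ≤ m} θ ^ j r ^ {-(x(1) + ⋯ + x(j))}`. -/
def lyapunov (θ r : ℝ) (m : ℕ) (x : Fin d → ℤ) : ℝ :=
  ∑ j ∈ Finset.range (m + 1), θ ^ j * r ^ (-partialSum x j)

theorem lyapunov_nonneg {θ r : ℝ} (hθ : 0 < θ) (hr : 0 < r) (m : ℕ) (x : Fin d → ℤ) :
    0 ≤ lyapunov θ r m x :=
  Finset.sum_nonneg fun _ _ => by positivity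

theorem lyapunov_succ (θ r : ℝ) (m : ℕ) (x : Fin d → ℤ) :
    lyapunov θ r (m + 1) x = lyapunov θ r m x + θ ^ (m + 1) * r ^ (-partialSum x (m + 1)) :=
  Finset.sum_range_succ _ _

theorem le_lyapunov {θ r : ℝ} (hθ : 0 < θ) (hr : 0 < r) (m : ℕ) (x : Fin d → ℤ) :
    θ ^ m * r ^ (-partialSum x m) ≤ lyapunov θ r m x := by
  rw [lyapunov]
  exact Finset.single_le_sum (f := fun j => θ ^ j * r ^ (-partialSum x j))
    (fun _ _ => by positivity) (Finset.self_mem_range_succ m)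

theorem lyapunov_le {θ r : ℝ} (hθ : 0 < θ) (hθ1 : θ ≤ 1) (hr : 0 < r) (hr1 : r < 1) {m : ℕ}
    {x : Fin d → ℤ} {n : ℤ} (h : ∀ j ≤ m, partialSum x j ≤ n) :
    lyapunov θ r m x ≤ (m + 1) * r ^ (-n) := by
  have hle : ∀ j ∈ Finset.range (m + 1), θ ^ j * r ^ (-partialSum x j) ≤ r ^ (-n) := by
    intro j hj
    have h1 : θ ^ j ≤ 1 := pow_le_one₀ hθ.le hθ1
    have h2 : r ^ (-partialSum x j) ≤ r ^ (-n) :=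
      zpow_le_zpow_right_of_le_one₀ hr hr1.le
        (neg_le_neg (h j (Finset.mem_range_succ_iff.1 hj)))
    calc θ ^ j * r ^ (-partialSum x j) ≤ 1 * r ^ (-n) := by gcongr
      _ = _ := one_mul _
  calc lyapunov θ r m x ≤ ∑ _j ∈ Finset.range (m + 1), r ^ (-n) := Finset.sum_le_sum hle
    _ = _ := by simp

/-- The parameters for which the drift of `lyapunov θ r m` is under control. -/
structure IsLyapunovParam (lam : ℝ) (mu : Fin d → ℝ) (κ θ r : ℝ) : Prop where
  κ_pos : 0 < κ
  θ_pos : 0 < θ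
  θ_lt : θ < 1
  r_pos : 0 < r
  r_lt : r < 1
  drift : ∀ i, lam * (1 / r - 1) - mu i * (1 - r) ≤ -κ
  small : lam * (1 / r - 1) * θ ≤ κ / 2 * (1 - θ)

theorem exists_isLyapunovParam {lam : ℝ} {mu : Fin d → ℝ} (hlam : 0 < lam) {q r : ℝ}
    (hq : 0 < q) (hmu : ∀ i, lam / q ≤ mu i) (hqr : q < r) (hr1 : r < 1) :
    ∃ κ θ, IsLyapunovParam lam mu κ θ r := by
  have hr : 0 < r := hq.trans hqr
  have hdiv : lam / r < lam / q := div_lt_div_of_pos_left hlam hq hqr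
  -- The drift in question is (1 - r)(lam / r - mu i), and mu i ≥ lam / q.
  set κ := (1 - r) * (lam / q - lam / r) with hκdef
  have hκ : 0 < κ := mul_pos (by linarith) (by linarith)
  set β := lam * (1 / r - 1) with hβdef
  have hβ : 0 < β := mul_pos hlam (sub_pos.2 (one_lt_one_div hr hr1))
  have hden : 0 < κ / 2 + β := by positivity
  -- This θ turns the condition `small` into an equality.
  refine ⟨κ, (κ / 2) / (κ / 2 + β), hκ, by positivity, ?_, hr, hr1, fun i => ?_, ?_⟩
  · rw [div_lt_one hden]
    linarith
  · have h1 : lam / q * (1 - r) ≤ mu i * (1 - r) :=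
      mul_le_mul_of_nonneg_right (hmu i) (by linarith)
    have h2 : lam * (1 / r - 1) = (1 - r) * (lam / r) := by
      field_simp
    rw [h2, hκdef]
    nlinarith
  · rw [← hβdef]
    apply le_of_eq
    field_simp
    ring

variable [NeZero d]

/-- Only an arrival or the service at node `i` changes this partial sum: an arrival multiplies the
power by 1 / r, an accepted service by r. -/
theorem mean_zpow_partialSum {lam : ℝ} {mu : Fin d → ℝ} (hsum : lam + ∑ i, mu i = 1) {r : ℝ}
    (hr : 0 < r) {x : Fin d → ℤ} {D : (Fin d → ℤ) → Fin d → ℤ} (hD : IsMotion x D) (i : Fin d) :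
    (D (service i) = service i ∧
      mean lam mu (fun e => r ^ (-partialSum (x + D e) (i + 1))) - r ^ (-partialSum x (i + 1)) =
        (lam * (1 / r - 1) - mu i * (1 - r)) * r ^ (-partialSum x (i + 1))) ∨
    (D (service i) = 0 ∧ x i = 0 ∧
      mean lam mu (fun e => r ^ (-partialSum (x + D e) (i + 1))) - r ^ (-partialSum x (i + 1)) =
        lam * (1 / r - 1) * r ^ (-partialSum x (i + 1))) := by
  rw [mean_sub_eq hsum, Finset.sum_eq_single i]
  · have harr : r ^ (-partialSum (x + D (arrival d)) (i + 1)) =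
        r ^ (-partialSum x (i + 1)) * (1 / r) := by
      rw [hD.arrival, partialSum_add, partialSum_arrival (by omega), neg_add, zpow_add₀ hr.ne',
        zpow_neg_one, one_div]
    rw [harr]
    rcases hD.service i with h | ⟨h, hx⟩
    · left
      refine ⟨h, ?_⟩
      have hs : r ^ (-partialSum (x + D (service i)) (i + 1)) =
          r ^ (-partialSum x (i + 1)) * r := by
        rw [h, partialSum_add, partialSum_service i (by omega), if_pos rfl, neg_add, neg_neg,
          zpow_add₀ hr.ne', zpow_one]
      rw [hs]
      ring
    · right
      refine ⟨h, hx, ?_⟩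
      rw [h, add_zero]
      ring
  · intro k _ hk
    have : partialSum (x + D (service k)) (i + 1) = partialSum x (i + 1) := by
      rcases hD.service k with h | ⟨h, -⟩
      · rw [h, partialSum_add, partialSum_service k (by omega), if_neg, add_zero]
        intro h'
        exact hk (Fin.ext (by omega))
      · rw [h, add_zero]
    rw [this, sub_self, mul_zero]
  · simp

theorem mean_lyapunov_zero {lam : ℝ} {mu : Fin d → ℝ} (hsum : lam + ∑ i, mu i = 1) (θ r : ℝ)
    (x : Fin d → ℤ) (D : (Fin d → ℤ) → Fin d → ℤ) :
    mean lam mu (fun e => lyapunov θ r 0 (x + D e)) = lyapunov θ r 0 x := by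
  simp [lyapunov, mean_const hsum]

/-- The subtracted term is a reserve handed from one index to the next. If the service is accepted,
the drift -κ of the new term supplies the new reserve. If it is blocked, the node is empty and the
two partial sums agree; by `small` the old reserve then pays for both the growth of the new term and
the new reserve. -/
theorem mean_lyapunov_succ_le {lam : ℝ} {mu : Fin d → ℝ}
    (hsum : lam + ∑ i, mu i = 1) {κ θ r : ℝ} (h : IsLyapunovParam lam mu κ θ r)
    {x : Fin d → ℤ} {D : (Fin d → ℤ) → Fin d → ℤ} (hD : IsMotion x D) (i : Fin d) {c : ℝ}
    (hc : mean lam mu (fun e => lyapunov θ r i (x + D e)) - lyapunov θ r i x ≤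
      c - κ / 2 * (θ ^ (i : ℕ) * r ^ (-partialSum x i))) :
    mean lam mu (fun e => lyapunov θ r (i + 1) (x + D e)) - lyapunov θ r (i + 1) x ≤
      c - κ / 2 * (θ ^ ((i : ℕ) + 1) * r ^ (-partialSum x (i + 1))) := by
  obtain ⟨hκ, hθ, hθ1, hr, hr1, hdr, hsm⟩ := h
  simp only [lyapunov_succ, mean_add, mean_const_mul]
  have hpow : (0 : ℝ) < θ ^ (i : ℕ) := by positivity
  have hz : (0 : ℝ) < r ^ (-partialSum x i) := by positivity
  have hz' : (0 : ℝ) < r ^ (-partialSum x (i + 1)) := by positivity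
  rcases mean_zpow_partialSum (lam := lam) (mu := mu) hsum hr hD i with ⟨-, he⟩ | ⟨-, hx, he⟩
  · have h1 : θ ^ ((i : ℕ) + 1) * (mean lam mu (fun e => r ^ (-partialSum (x + D e) (i + 1))) -
        r ^ (-partialSum x (i + 1))) ≤
        θ ^ ((i : ℕ) + 1) * (-κ * r ^ (-partialSum x (i + 1))) := by
      rw [he]
      have := hdr i
      gcongr
    have h2 : 0 < κ / 2 * (θ ^ (i : ℕ) * r ^ (-partialSum x i)) := by positivity
    have h3 : 0 < κ / 2 * (θ ^ ((i : ℕ) + 1) * r ^ (-partialSum x (i + 1))) := by positivity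
    nlinarith
  · have hS : partialSum x (i + 1) = partialSum x i := by rw [partialSum_succ, hx, add_zero]
    have he' : θ ^ ((i : ℕ) + 1) * (mean lam mu (fun e => r ^ (-partialSum (x + D e) (i + 1))) -
        r ^ (-partialSum x (i + 1))) =
          (lam * (1 / r - 1) * θ) * (θ ^ (i : ℕ) * r ^ (-partialSum x i)) := by
      rw [he, hS]
      ring
    have h1 : (lam * (1 / r - 1) * θ) * (θ ^ (i : ℕ) * r ^ (-partialSum x i)) ≤
        (κ / 2 * (1 - θ)) * (θ ^ (i : ℕ) * r ^ (-partialSum x i)) :=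
      mul_le_mul_of_nonneg_right hsm (by positivity)
    have h2 : θ ^ ((i : ℕ) + 1) * r ^ (-partialSum x (i + 1)) =
        θ * (θ ^ (i : ℕ) * r ^ (-partialSum x i)) := by
      rw [hS]
      ring
    rw [mul_sub] at he'
    rw [h2] at he' ⊢
    linarith

theorem mean_lyapunov_le {lam : ℝ} {mu : Fin d → ℝ}
    (hsum : lam + ∑ i, mu i = 1) {κ θ r : ℝ} (h : IsLyapunovParam lam mu κ θ r)
    {x : Fin d → ℤ} {D : (Fin d → ℤ) → Fin d → ℤ} (hD : IsMotion x D) {m : ℕ} (hm : m ≤ d) :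
    mean lam mu (fun e => lyapunov θ r m (x + D e)) - lyapunov θ r m x ≤
      κ / 2 - κ / 2 * (θ ^ m * r ^ (-partialSum x m)) := by
  induction m with
  | zero => simp [mean_lyapunov_zero hsum]
  | succ m ih => exact mean_lyapunov_succ_le hsum h hD ⟨m, hm⟩ (ih (by omega))

/-- The constant κ / 2 in `mean_lyapunov_le` is the reserve of the constant term j = 0, needed only
if the first node can block. If it never blocks, the induction starts at the first node with
constant 0. -/
theorem mean_lyapunov_le_of_service_zero {lam : ℝ} {mu : Fin d → ℝ}
    (hsum : lam + ∑ i, mu i = 1) {κ θ r : ℝ} (h : IsLyapunovParam lam mu κ θ r)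
    {x : Fin d → ℤ} {D : (Fin d → ℤ) → Fin d → ℤ} (hD : IsMotion x D)
    (h0 : D (service 0) = service 0) :
    mean lam mu (fun e => lyapunov θ r d (x + D e)) ≤ lyapunov θ r d x := by
  have key : ∀ m, m + 1 ≤ d →
      mean lam mu (fun e => lyapunov θ r (m + 1) (x + D e)) - lyapunov θ r (m + 1) x ≤
        0 - κ / 2 * (θ ^ (m + 1) * r ^ (-partialSum x (m + 1))) := by
    intro m
    induction m with
    | zero =>
      intro _
      have hs : service (0 : Fin d) ≠ 0 := fun hc => by
        have := congrFun hc 0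
        simp [service] at this
      simp only [lyapunov_succ, mean_add, mean_const_mul, mean_lyapunov_zero hsum]
      rcases mean_zpow_partialSum (lam := lam) (mu := mu) hsum h.r_pos hD 0 with
        ⟨-, he⟩ | ⟨hc, -, -⟩
      · have hz : (0 : ℝ) < r ^ (-partialSum x (0 + 1)) := by have := h.r_pos; positivity
        have h1 : mean lam mu (fun e => r ^ (-partialSum (x + D e) (0 + 1))) -
            r ^ (-partialSum x (0 + 1)) ≤ -κ * r ^ (-partialSum x (0 + 1)) := by
          simp only [Fin.val_zero] at he
          rw [he]
          exact mul_le_mul_of_nonneg_right (h.drift 0) hz.le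
        have h2 := mul_le_mul_of_nonneg_left h1 h.θ_pos.le
        have h3 : 0 < κ / 2 * (θ * r ^ (-partialSum x (0 + 1))) := by
          have := h.κ_pos
          have := h.θ_pos
          positivity
        rw [mul_sub] at h2
        simp only [zero_add, pow_one] at h2 h3 ⊢
        linarith
      · exact absurd (h0.symm.trans hc) hs
    | succ m ih =>
      intro hm
      exact mean_lyapunov_succ_le hsum h hD ⟨m + 1, hm⟩ (ih (by omega))
  obtain ⟨m, rfl⟩ : ∃ m, d = m + 1 := Nat.exists_eq_succ_of_ne_zero (NeZero.ne d)
  have h1 := key m le_rfl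
  have h2 : 0 < κ / 2 * (θ ^ (m + 1) * r ^ (-partialSum x (m + 1))) := by
    obtain ⟨hκ, hθ, -, hr, -⟩ := h
    positivity
  linarith

end Drift

/-! ### Recurrence of the stable walk. -/

section Recurrence

variable {d : ℕ}

/-- The total number of services needed to empty the system in state `x`. -/
def workload {d : ℕ} (x : Fin d → ℤ) : ℤ := ∑ j ∈ Finset.range d, partialSum x (j + 1)

theorem workload_add (x y : Fin d → ℤ) : workload (x + y) = workload x + workload y := by
  simp only [workload, partialSum_add, Finset.sum_add_distrib]

theorem workload_service (i : Fin d) : workload (service i) = -1 := by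
  rw [workload, Finset.sum_eq_single (i : ℕ)]
  · rw [partialSum_service i (by omega), if_pos rfl]
  · intro j hj hji
    have := Finset.mem_range.1 hj
    rw [partialSum_service i (by omega), if_neg (by omega)]
  · intro h
    exact absurd (Finset.mem_range.2 i.2) h

theorem workload_nonneg {x : Fin d → ℤ} (hx : ∀ i, 0 ≤ x i) : 0 ≤ workload x :=
  Finset.sum_nonneg fun _ _ => partialSum_nonneg hx _

theorem workload_le {x : Fin d → ℤ} (hx : ∀ i, 0 ≤ x i) : workload x ≤ d * partialSum x d := by
  have h : ∀ j ∈ Finset.range d, partialSum x (j + 1) ≤ partialSum x d := fun j hj =>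
    partialSum_mono hx (Finset.mem_range.1 hj)
  calc workload x ≤ ∑ _j ∈ Finset.range d, partialSum x d := Finset.sum_le_sum h
    _ = _ := by simp

theorem two_zpow_neg_workload_le_one {x : Fin d → ℤ} (hx : ∀ i, 0 ≤ x i) :
    (2 : ℝ) ^ (-workload x) ≤ 1 :=
  zpow_le_one_of_nonpos₀ one_le_two (by have := workload_nonneg hx; omega)

variable [NeZero d]

/-- Every accepted service doubles 2^{-workload}, and off the origin some node can serve, a gain of
at least `mu i` times the value. An arrival loses at most `lam` times the value. -/
theorem le_mean_two_zpow_workload {lam : ℝ} {mu : Fin d → ℝ} (hlam : 0 < lam)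
    (hsum : lam + ∑ i, mu i = 1) {δ : ℝ} (hδ : 0 ≤ δ) (hmu : ∀ i, lam + δ ≤ mu i) {x : Fin d → ℤ}
    (hx : ∀ i, 0 ≤ x i) (hx0 : x ≠ 0) :
    δ * 2 ^ (-workload x) ≤
      mean lam mu (fun e => (2 : ℝ) ^ (-workload (x + constrain x e))) - 2 ^ (-workload x) := by
  set p : ℝ := 2 ^ (-workload x) with hp
  have hp0 : 0 < p := by positivity
  rw [mean_sub_eq hsum]
  have hserv : ∀ i, (2 : ℝ) ^ (-workload (x + service i)) = 2 * p := fun i => by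
    rw [workload_add, workload_service, neg_add, neg_neg, zpow_add₀ two_ne_zero, zpow_one, mul_comm]
  have hterm : ∀ i, (0 < x i → mu i * ((2 : ℝ) ^ (-workload (x + constrain x (service i))) - p) =
        mu i * p) ∧
      0 ≤ mu i * ((2 : ℝ) ^ (-workload (x + constrain x (service i))) - p) := by
    intro i
    have hmi : 0 ≤ mu i := by linarith [hmu i]
    rw [constrain_service hx]
    by_cases h : 0 < x i
    · rw [if_pos h, hserv]
      exact ⟨fun _ => by ring, mul_nonneg hmi (by linarith)⟩
    · rw [if_neg h, add_zero, ← hp, sub_self, mul_zero]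
      exact ⟨fun h' => absurd h' h, le_rfl⟩
  obtain ⟨i, hi⟩ := exists_pos_of_ne_zero hx hx0
  have h1 := Finset.single_le_sum (fun i _ => (hterm i).2) (Finset.mem_univ i)
  rw [(hterm i).1 hi] at h1
  have h2 : -(lam * p) ≤ lam * ((2 : ℝ) ^ (-workload (x + constrain x (arrival d))) - p) := by
    have : (0 : ℝ) < 2 ^ (-workload (x + constrain x (arrival d))) := by positivity
    nlinarith
  have h3 := mul_le_mul_of_nonneg_right (hmu i) hp0.le
  nlinarith

/-- A function of small exponential growth whose drift off the origin is at most `-1`. -/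
theorem exists_drift_le_neg_one {lam : ℝ} {mu : Fin d → ℝ} (hlam : 0 < lam)
    (hsum : lam + ∑ i, mu i = 1) {q r : ℝ} (hq : 0 < q) (hmu : ∀ i, lam / q ≤ mu i)
    (hqr : q < r) (hr1 : r < 1) :
    ∃ (V : (Fin d → ℤ) → ℝ) (C : ℝ), 0 < C ∧ (∀ x, (∀ i, 0 ≤ x i) → 0 ≤ V x) ∧
      (∀ x, (∀ i, 0 ≤ x i) → x ≠ 0 →
        mean lam mu (fun e => V (x + constrain x e)) ≤ V x - 1) ∧
      ∀ x, (∀ i, 0 ≤ x i) → ∀ n : ℕ, partialSum x d ≤ n → V x ≤ C * r ^ (-(n : ℤ)) := by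
  obtain ⟨κ, θ, hp⟩ := exists_isLyapunovParam (mu := mu) hlam hq hmu hqr hr1
  obtain ⟨hκ, hθ, hθ1, hr, -, -, -⟩ := id hp
  set δ := lam / q - lam with hδ
  have hδ0 : 0 < δ := by
    have : lam < lam / q := by
      rw [lt_div_iff₀ hq]
      nlinarith
    linarith
  -- Once the total is at least b, the Lyapunov drift is at most κ / 2 - κ = -κ / 2.
  obtain ⟨b, hb⟩ : ∃ b : ℕ, 2 ≤ θ ^ d * r ^ (-(b : ℤ)) := by
    have h1 : 1 < 1 / r := one_lt_one_div hr hr1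
    obtain ⟨b, hb⟩ := pow_unbounded_of_one_lt (2 / θ ^ d) h1
    refine ⟨b, ?_⟩
    rw [div_lt_iff₀ (by positivity)] at hb
    rw [zpow_neg, zpow_natCast, ← inv_pow, ← one_div]
    linarith
  -- Where the total is below b the workload is at most d * b, so the correction -K 2^{-workload}
  -- contributes drift at most -κ there and outweighs the positive κ / 2.
  set K := κ * 2 ^ (d * b) / δ with hK
  have hK0 : 0 < K := by positivity
  have hc : 0 < 2 / κ := by positivity
  refine ⟨fun x => 2 / κ * (lyapunov θ r d x + (K + -K * 2 ^ (-workload x))),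
    2 / κ * (d + 1 + K), by positivity, fun x hx => ?_, fun x hx hx0 => ?_, fun x hx n hn => ?_⟩
  · have h1 := lyapunov_nonneg hθ hr d x
    have h2 := mul_le_mul_of_nonneg_left (two_zpow_neg_workload_le_one hx) hK0.le
    refine mul_nonneg hc.le ?_
    linarith
  · have h1 := mean_lyapunov_le hsum hp (isMotion_constrain hx) le_rfl
    have h2 := le_mean_two_zpow_workload hlam hsum hδ0.le (fun i => by
      rw [hδ]; linarith [hmu i] : ∀ i, lam + δ ≤ mu i) hx hx0
    have h2' := mul_le_mul_of_nonneg_left h2 hK0.le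
    simp only [mean_const_mul, mean_add, mean_const hsum]
    suffices h : κ / 2 - κ / 2 * (θ ^ d * r ^ (-partialSum x d)) -
        K * (δ * 2 ^ (-workload x)) ≤ -(κ / 2) by
      have h3 : 2 / κ * (-(κ / 2)) = -1 := by field_simp
      have h4 := mul_le_mul_of_nonneg_left (show
        (mean lam mu (fun e => lyapunov θ r d (x + constrain x e)) + (K + -K *
          mean lam mu (fun e => (2 : ℝ) ^ (-workload (x + constrain x e))))) -
        (lyapunov θ r d x + (K + -K * 2 ^ (-workload x))) ≤ -(κ / 2) by linarith) hc.le
      rw [h3, mul_sub] at h4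
      linarith
    by_cases hxb : partialSum x d < b
    · have h3 : (2 : ℝ) ^ (-((d * b : ℕ) : ℤ)) ≤ 2 ^ (-workload x) := by
        refine zpow_le_zpow_right₀ one_le_two ?_
        have h4 := workload_le hx
        have h5 : (d : ℤ) * partialSum x d ≤ d * b :=
          mul_le_mul_of_nonneg_left hxb.le (by positivity)
        push_cast
        omega
      have h4 : K * (δ * 2 ^ (-((d * b : ℕ) : ℤ))) = κ := by
        rw [hK, zpow_neg, zpow_natCast]
        field_simp
      have h5 : K * (δ * 2 ^ (-((d * b : ℕ) : ℤ))) ≤ K * (δ * 2 ^ (-workload x)) := by gcongr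
      have h6 : 0 < κ / 2 * (θ ^ d * r ^ (-partialSum x d)) := by positivity
      linarith
    · have h3 : θ ^ d * r ^ (-(b : ℤ)) ≤ θ ^ d * r ^ (-partialSum x d) := by
        refine mul_le_mul_of_nonneg_left ?_ (by positivity)
        exact zpow_le_zpow_right_of_le_one₀ hr hr1.le (by omega)
      have h4 := mul_le_mul_of_nonneg_left (hb.trans h3) (by positivity : 0 ≤ κ / 2)
      have h5 : 0 < K * (δ * 2 ^ (-workload x)) := by positivity
      linarith
  · have h1 : lyapunov θ r d x ≤ (d + 1) * r ^ (-(n : ℤ)) :=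
      lyapunov_le hθ hθ1.le hr hr1 fun j hj => (partialSum_mono hx hj).trans hn
    have h2 : (1 : ℝ) ≤ r ^ (-(n : ℤ)) := by
      rw [zpow_neg, zpow_natCast, one_le_inv₀ (by positivity)]
      exact pow_le_one₀ hr.le hr1.le
    have h3 : 0 < K * 2 ^ (-workload x) := by positivity
    rw [mul_assoc]
    refine mul_le_mul_of_nonneg_left ?_ hc.le
    have h4 := mul_le_mul_of_nonneg_left h2 hK0.le
    nlinarith

theorem X_eq_run {d : ℕ} (x : Fin d → ℤ) (k : ℕ) (v : ℕ → Fin d → ℤ) :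
    X x k v = run (fun x e => x + constrain x e) x k v := by
  induction k with
  | zero => rfl
  | succ k ih => rw [X, run, ih]

theorem X_nonneg {d : ℕ} {x : Fin d → ℤ} (hx : ∀ i, 0 ≤ x i) (k : ℕ) (v : ℕ → Fin d → ℤ)
    (i : Fin d) : 0 ≤ X x k v i := by
  induction k generalizing i with
  | zero => exact hx i
  | succ k ih => exact add_constrain_nonneg ih _ i

theorem run_fst_clock {S : Type*} {d : ℕ} (f : S → (Fin d → ℤ) → S) (s : S) (m k : ℕ)
    (v : ℕ → Fin d → ℤ) :
    run (fun (p : S × ℕ) e => (f p.1 e, p.2 + 1)) (s, m) k v = (run f s k v, m + k) := by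
  induction k with
  | zero => rfl
  | succ k ih => rw [run, ih, run, add_assoc]

/-- The stable walk reaches the origin almost surely. -/
theorem ae_exists_X_eq_zero {lam : ℝ} {mu : Fin d → ℝ} (hlam : 0 < lam) (hmu : ∀ i, lam < mu i)
    (hsum : lam + ∑ i, mu i = 1) {V : (Fin d → ℤ) → ℝ}
    (hV : ∀ x, (∀ i, 0 ≤ x i) → 0 ≤ V x)
    (hdrift : ∀ x, (∀ i, 0 ≤ x i) → x ≠ 0 →
      mean lam mu (fun e => V (x + constrain x e)) ≤ V x - 1) {x : Fin d → ℤ}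
    (hx : ∀ i, 0 ≤ x i) : ∀ᵐ v ∂pathLaw lam mu, ∃ k, X x k v = 0 := by
  have hle : ∀ m : ℕ, 0 < m →
      pathLaw lam mu {v | ¬ ∃ k, X x k v = 0} ≤ ENNReal.ofReal (V x / m) := by
    intro m hm
    have hm' : (0 : ℝ) < m := Nat.cast_pos.2 hm
    -- With a clock t adjoined, V + t is a supermartingale off the origin; surviving to time m thus
    -- has probability at most V x / m.
    have h := pathLaw_reach_le hlam hmu hsum
      (fun (p : (Fin d → ℤ) × ℕ) e => (p.1 + constrain p.1 e, p.2 + 1))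
      {p | ∀ i, 0 ≤ p.1 i} {p | m ≤ p.2} {p | p.1 ≠ 0} (fun p => (V p.1 + p.2) / m)
      (fun p hp => by have := hV p.1 hp; positivity)
      (fun p hp hpm => by
        rw [le_div_iff₀ hm', one_mul]
        have h1 := hV p.1 hp
        have h2 : (m : ℝ) ≤ p.2 := Nat.cast_le.2 hpm
        linarith)
      (fun p hp _ e _ => add_constrain_nonneg hp e)
      (fun p hp hp0 => by
        have h1 := hdrift p.1 hp hp0
        simp only [div_eq_inv_mul, mean_const_mul, mean_add, mean_const hsum]
        refine mul_le_mul_of_nonneg_left ?_ (by positivity)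
        push_cast
        linarith)
      (s := (x, 0)) hx
    simp only [Nat.cast_zero, add_zero] at h
    refine (measure_mono ?_).trans h
    intro v hv
    simp only [Set.mem_ofPred_eq, not_exists] at hv
    refine ⟨m, ?_, fun i _ => ?_⟩
    · simp [run_fst_clock (fun x e => x + constrain x e)]
    · simpa [run_fst_clock (fun x e => x + constrain x e), ← X_eq_run] using hv i
  have hlim : Tendsto (fun m : ℕ => ENNReal.ofReal (V x / m)) atTop (𝓝 0) := by
    have h := ENNReal.tendsto_ofReal (tendsto_const_div_atTop_nhds_zero_nat (V x))
    rwa [ENNReal.ofReal_zero] at h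
  refine le_antisymm (ge_of_tendsto hlim ?_) zero_le
  filter_upwards [eventually_gt_atTop 0] with m hm using hle m hm

end Recurrence

/-! ### Coupling of the walk with the walk unconstrained at the first node. -/

section Coupling

variable {d : ℕ}

theorem tauX_lt_iff (n : ℕ) {x : Fin d → ℤ} (hx : ∀ i, 0 ≤ x i) (v : ℕ → Fin d → ℤ) :
    tauX x n v < tauX x 0 v ↔ ∃ k, partialSum (X x k v) d = n ∧ ∀ i ≤ k, X x i v ≠ 0 := by
  have hA : ∀ (N k : ℕ), X x k v ∈ boundaryA d N ↔ partialSum (X x k v) d = N := fun N k => by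
    simp only [boundaryA, Set.mem_ofPred_eq, partialSum_top]
    exact ⟨fun h => h.2, fun h => ⟨X_nonneg hx k v, h⟩⟩
  have h0 : ∀ k, X x k v ∈ boundaryA d 0 ↔ X x k v = 0 := fun k => by
    rw [hA, eq_zero_iff_partialSum (X_nonneg hx k v), Nat.cast_zero]
  constructor
  · intro h
    have htop : tauX x n v ≠ ⊤ := (h.trans_le le_top).ne
    have hmem := hittingAfter_mem_set_of_ne_top htop
    refine ⟨_, (hA n _).1 hmem, fun i hi hzero => ?_⟩
    have h1 : tauX x 0 v ≤ i := hittingAfter_le_of_mem (Nat.zero_le i) ((h0 i).2 hzero)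
    have h2 : ((tauX x n v).untopA : WithTop ℕ) = tauX x n v := by
      rw [WithTop.untopA_eq_untop htop]
      exact WithTop.coe_untop _ htop
    have h3 : (i : WithTop ℕ) ≤ tauX x n v := by
      rw [← h2]
      exact_mod_cast hi
    exact absurd h (not_lt.2 (h1.trans h3))
  · rintro ⟨k, hk, hk0⟩
    have h1 : tauX x n v ≤ k := hittingAfter_le_of_mem (Nat.zero_le k) ((hA n k).2 hk)
    refine h1.trans_lt (lt_of_not_ge fun hle => ?_)
    obtain ⟨i, hi, hi0⟩ := hittingAfter_le_iff.1 hle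
    exact hk0 i hi.2 ((h0 i).1 hi0)

/-- A discrete intermediate value theorem: a sequence that falls by at most one per step cannot jump
over a level. -/
theorem exists_eq_of_ge_sub_one {a : ℕ → ℤ} {n : ℤ} (ha : ∀ k, a k - 1 ≤ a (k + 1)) (h0 : n ≤ a 0)
    {t : ℕ} (ht : a t ≤ n) : ∃ k ≤ t, a k = n := by
  induction t with
  | zero => exact ⟨0, le_rfl, le_antisymm ht h0⟩
  | succ t ih =>
    by_cases h : a t ≤ n
    · obtain ⟨k, hk, hk'⟩ := ih h
      exact ⟨k, by omega, hk'⟩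
    · exact ⟨t + 1, le_rfl, by have := ha t; omega⟩

theorem exists_eq_of_le_add_one {a : ℕ → ℤ} {n : ℤ} (ha : ∀ k, a (k + 1) ≤ a k + 1) (h0 : a 0 ≤ n)
    {t : ℕ} (ht : n ≤ a t) : ∃ k ≤ t, a k = n := by
  obtain ⟨k, hk, h⟩ := exists_eq_of_ge_sub_one (a := fun k => -a k) (n := -n) (t := t)
    (fun k => by have := ha k; omega) (by omega) (by omega)
  exact ⟨k, hk, by omega⟩

open scoped Classical in
theorem partialSum_add_constrain_service {x : Fin d → ℤ} (hx : ∀ i, 0 ≤ x i) (i : Fin d) {j : ℕ}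
    (hj : j ≤ d) : partialSum (x + constrain x (service i)) j =
      partialSum x j - if j = (i : ℕ) + 1 ∧ 0 < x i then 1 else 0 := by
  rw [constrain_service hx, partialSum_add]
  by_cases h : 0 < x i
  · rw [if_pos h, partialSum_service i hj]
    simp only [h, and_true]
    split_ifs <;> rfl
  · simp [h]

/-- The stage of the coupling: it is incremented when the node of index `m` is empty. -/
def nextStage (x : Fin d → ℤ) (m : ℕ) : ℕ :=
  if m < d ∧ partialSum x (m + 1) = partialSum x m then m + 1 else m

theorem le_nextStage (x : Fin d → ℤ) (m : ℕ) : m ≤ nextStage x m := by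
  unfold nextStage
  split_ifs <;> omega

theorem nextStage_le {m : ℕ} (hm : m ≤ d) (x : Fin d → ℤ) : nextStage x m ≤ d := by
  unfold nextStage
  split_ifs <;> omega

variable [NeZero d]

/-- The walk `T_n⁻¹ Y`: the walk `X` without the constraint at the first node. -/
def freeX (w : Fin d → ℤ) (k : ℕ) (v : ℕ → Fin d → ℤ) : Fin d → ℤ :=
  run (fun w e => w + constrain₁ w e) w k v

theorem T_add (n : ℕ) (w u : Fin d → ℤ) : T n (w + u) = T n w + reflect u := by
  funext i
  simp only [T, reflect, Pi.add_apply]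
  split_ifs <;> ring

theorem constrain₁_T (n : ℕ) (w e : Fin d → ℤ) :
    constrain₁ (T n w) (reflect e) = reflect (constrain₁ w e) := by
  have h : (∀ i, i ≠ 0 → 0 ≤ T n w i + reflect e i) ↔ ∀ i, i ≠ 0 → 0 ≤ w i + e i := by
    refine forall₂_congr fun i hi => ?_
    simp [T, reflect, hi]
  simp only [constrain₁, h]
  split_ifs
  · rfl
  · funext i
    simp [reflect]

theorem Y_T (n : ℕ) (w : Fin d → ℤ) (k : ℕ) (v : ℕ → Fin d → ℤ) :
    Y (T n w) k v = T n (freeX w k v) := by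
  induction k with
  | zero => rfl
  | succ k ih => rw [Y, ih, constrain₁_T, ← T_add]; rfl

theorem freeX_nonneg {w : Fin d → ℤ} (hw : ∀ i, i ≠ 0 → 0 ≤ w i) (k : ℕ) (v : ℕ → Fin d → ℤ)
    (i : Fin d) (hi : i ≠ 0) : 0 ≤ freeX w k v i := by
  induction k generalizing i with
  | zero => exact hw i hi
  | succ k ih => exact add_constrain₁_nonneg (fun i hi => ih i hi) _ i hi

theorem T_mem_boundaryB (n : ℕ) {w : Fin d → ℤ} (hw : ∀ i, i ≠ 0 → 0 ≤ w i) :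
    T n w ∈ boundaryB d ↔ partialSum w d = n := by
  have h0 : T n w 0 = n - w 0 := by simp [T, reflect, sub_eq_add_neg]
  have hj : ∀ j, j ≠ 0 → T n w j = w j := fun j hj => by simp [T, reflect, hj]
  have hs : ∑ j ∈ Finset.univ.erase 0, T n w j = ∑ j ∈ Finset.univ.erase 0, w j :=
    Finset.sum_congr rfl fun j hj' => hj j (Finset.ne_of_mem_erase hj')
  have ht : partialSum w d = w 0 + ∑ j ∈ Finset.univ.erase 0, w j := by
    rw [partialSum_top, Finset.add_sum_erase _ _ (Finset.mem_univ 0)]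
  have hn : ∀ i, i ≠ 0 → 0 ≤ T n w i := fun i hi => (hj i hi).symm ▸ hw i hi
  simp only [boundaryB, Set.mem_ofPred_eq, hs, h0, ht]
  exact ⟨fun h => by linarith [h.2], fun h => ⟨hn, by linarith⟩⟩

theorem tauY_lt_top_iff (n : ℕ) {w : Fin d → ℤ} (hw : ∀ i, i ≠ 0 → 0 ≤ w i)
    (v : ℕ → Fin d → ℤ) : tauY (T n w) v < ⊤ ↔ ∃ k, partialSum (freeX w k v) d = n := by
  rw [tauY, lt_top_iff_ne_top, Ne, hittingAfter_eq_top_iff]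
  push Not
  refine exists_congr fun k => ?_
  rw [Y_T, T_mem_boundaryB n fun i hi => freeX_nonneg hw k v i hi]
  simp

theorem IsMotion.partialSum_top_bounds {x : Fin d → ℤ} {D : (Fin d → ℤ) → Fin d → ℤ}
    (hD : IsMotion x D) {e : Fin d → ℤ} (he : Jump e) :
    partialSum x d - 1 ≤ partialSum (x + D e) d ∧ partialSum (x + D e) d ≤ partialSum x d + 1 := by
  have h := partialSum_jump_top he
  have h' : D e = e ∨ D e = 0 := by
    rcases he with rfl | ⟨i, rfl⟩
    · exact Or.inl hD.arrival
    · exact (hD.service i).imp_right And.left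
  rw [partialSum_add]
  rcases h' with h' | h' <;> rw [h']
  · omega
  · simp

/-- The state of the coupled walks `X` and `freeX`. -/
structure IsCoupled (x w : Fin d → ℤ) : Prop where
  nonneg : ∀ i, 0 ≤ x i
  nonneg_free : ∀ i, i ≠ 0 → 0 ≤ w i
  le : ∀ j ≤ d, partialSum w j ≤ partialSum x j

theorem isCoupled_self {x : Fin d → ℤ} (hx : ∀ i, 0 ≤ x i) : IsCoupled x x :=
  ⟨hx, fun i _ => hx i, fun _ _ => le_rfl⟩

open scoped Classical in
theorem partialSum_add_constrain₁_service {x : Fin d → ℤ} (hx : ∀ i, i ≠ 0 → 0 ≤ x i) (i : Fin d)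
    {j : ℕ} (hj : j ≤ d) : partialSum (x + constrain₁ x (service i)) j =
      partialSum x j - if j = (i : ℕ) + 1 ∧ (i = 0 ∨ 0 < x i) then 1 else 0 := by
  rw [constrain₁_service hx, partialSum_add]
  by_cases h : i = 0 ∨ 0 < x i
  · rw [if_pos h, partialSum_service i hj]
    simp only [h, and_true]
    split_ifs <;> rfl
  · simp [h]

/-- The order could break only if a partial sum is equal for both walks and `X` alone serves at its
last node. But equality there and the order one index earlier give w i ≥ x i > 0, so the free walk
serves too. -/
theorem IsCoupled.step {x w : Fin d → ℤ} (h : IsCoupled x w) {e : Fin d → ℤ} (he : Jump e) :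
    IsCoupled (x + constrain x e) (w + constrain₁ w e) := by
  refine ⟨add_constrain_nonneg h.nonneg e, add_constrain₁_nonneg h.nonneg_free e, fun j hj => ?_⟩
  have hle := h.le j hj
  rcases he with rfl | ⟨i, rfl⟩
  · rw [constrain_arrival h.nonneg, constrain₁_arrival h.nonneg_free, partialSum_add,
      partialSum_add]
    omega
  · rw [partialSum_add_constrain_service h.nonneg i hj,
      partialSum_add_constrain₁_service h.nonneg_free i hj]
    by_cases hji : j = (i : ℕ) + 1
    · have h1 := partialSum_succ x i
      have h2 := partialSum_succ w i
      have h3 := h.le i i.2.le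
      rw [← hji] at h1 h2
      simp only [hji, true_and]
      rw [hji] at h1 h2 hle
      split_ifs <;> omega
    · simp only [hji, false_and, if_false]
      omega

/-- Beyond index m the coordinates themselves agree, so services are accepted together. At index m
an unchanged stage means that `X` is nonempty there, and the order of the partial sums then makes
the free walk able to serve as well. -/
theorem IsCoupled.step_eq {x w : Fin d → ℤ} (h : IsCoupled x w) {m : ℕ}
    (heq : ∀ j ≤ d, m < j → partialSum w j = partialSum x j) {e : Fin d → ℤ} (he : Jump e) {j : ℕ}
    (hj : j ≤ d) (hmj : nextStage x m < j) :
    partialSum (w + constrain₁ w e) j = partialSum (x + constrain x e) j := by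
  have hm := le_nextStage x m
  have hej := heq j hj (by omega)
  rcases he with rfl | ⟨i, rfl⟩
  · rw [constrain_arrival h.nonneg, constrain₁_arrival h.nonneg_free, partialSum_add,
      partialSum_add, hej]
  · rw [partialSum_add_constrain_service h.nonneg i hj,
      partialSum_add_constrain₁_service h.nonneg_free i hj, hej]
    by_cases hji : j = (i : ℕ) + 1
    · have h1 := partialSum_succ x i
      have h2 := partialSum_succ w i
      have h3 := h.le i i.2.le
      have h4 := h.nonneg i
      rw [hji] at hej
      have hact : (i = 0 ∨ 0 < w i) ↔ 0 < x i := by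
        rcases Nat.lt_or_ge m i with hmi | hmi
        · have h5 := heq i i.2.le hmi
          have h6 : i ≠ 0 := fun h => by subst h; simp at hmi
          simp only [h6, false_or]
          omega
        · have hmi' : m = i := by omega
          have h5 : ¬ (m < d ∧ partialSum x (m + 1) = partialSum x m) := by
            intro h5
            rw [nextStage, if_pos h5] at hmj
            omega
          rw [hmi'] at h5
          have h6 : 0 < x i := by
            by_contra h6
            exact h5 ⟨i.2, by omega⟩
          exact ⟨fun _ => h6, fun _ => Or.inr (by omega)⟩
      simp only [hact]
    · simp only [hji, false_and, if_false]

end Coupling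

/-! ### Absolute error of the approximation and lower bound on the hitting probability. -/

section Estimates

variable {d : ℕ}

/-- When the stage advances, the two partial sums agree, so the added term is at most the last old
one. The function at most doubles, which the factor 1 / 2 absorbs. -/
theorem lyapunov_nextStage_le {θ r : ℝ} (hθ : 0 < θ) (hθ1 : θ ≤ 1) (hr : 0 < r) (x : Fin d → ℤ)
    (m : ℕ) {a : ℝ} (ha : 0 ≤ a) :
    (1 / 2) ^ nextStage x m * (lyapunov θ r (nextStage x m) x + a) ≤
      (1 / 2) ^ m * (lyapunov θ r m x + a) := by
  unfold nextStage
  split_ifs with h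
  · rw [lyapunov_succ, h.2, pow_succ, mul_assoc]
    refine mul_le_mul_of_nonneg_left ?_ (by positivity)
    have h1 := le_lyapunov hθ hr m x
    have h2 : θ ^ (m + 1) * r ^ (-partialSum x m) ≤ θ ^ m * r ^ (-partialSum x m) :=
      mul_le_mul_of_nonneg_right (pow_le_pow_of_le_one hθ.le hθ1 (Nat.le_succ m)) (by positivity)
    linarith
  · exact le_rfl

theorem partialSum_top_ne_zero {x : Fin d → ℤ} {n : ℕ} (hn : n ≠ 0) (h : partialSum x d = n) :
    x ≠ 0 := by
  rintro rfl
  rw [partialSum_zero_left] at h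
  exact hn (by exact_mod_cast h.symm)

/-- Only subadditivity is used, so the hitting events need not be shown measurable. -/
theorem measureReal_le_add_of_sdiff_le {α : Type*} [MeasurableSpace α] {P : Measure α}
    [IsProbabilityMeasure P] {A B : Set α} {a : ℝ} (ha : 0 ≤ a)
    (h : P (A \ B) ≤ ENNReal.ofReal a) : P.real A ≤ P.real B + a := by
  have h1 : P.real (A \ B) ≤ a := ENNReal.toReal_le_of_le_ofReal ha h
  have h2 : P.real A ≤ P.real (B ∪ (A \ B)) := measureReal_mono (by simp)
  exact h2.trans ((measureReal_union_le _ _).trans (by gcongr))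

variable [NeZero d]

/-- The transition of the coupled walks `X` and `freeX` together with the stage. -/
def stageStep (p : (Fin d → ℤ) × (Fin d → ℤ) × ℕ) (e : Fin d → ℤ) :
    (Fin d → ℤ) × (Fin d → ℤ) × ℕ :=
  (p.1 + constrain p.1 e, p.2.1 + constrain₁ p.2.1 e, nextStage p.1 p.2.2)

theorem run_stageStep (x w : Fin d → ℤ) (m k : ℕ) (v : ℕ → Fin d → ℤ) :
    (run stageStep (x, w, m) k v).1 = X x k v ∧ (run stageStep (x, w, m) k v).2.1 = freeX w k v := by
  induction k with
  | zero => exact ⟨rfl, rfl⟩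
  | succ k ih =>
    refine ⟨?_, ?_⟩
    · rw [run, stageStep, X, ih.1]
    · rw [run, stageStep, freeX, run, ih.2]
      rfl

/-- The states which the coupled walks can reach at each stage. -/
def stageInv (d : ℕ) [NeZero d] : Set ((Fin d → ℤ) × (Fin d → ℤ) × ℕ) :=
  {p | IsCoupled p.1 p.2.1 ∧ p.2.2 ≤ d ∧
    ∀ j ≤ d, p.2.2 < j → partialSum p.2.1 j = partialSum p.1 j}

theorem stageStep_mem {p : (Fin d → ℤ) × (Fin d → ℤ) × ℕ} (hp : p ∈ stageInv d) {e : Fin d → ℤ}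
    (he : Jump e) : stageStep p e ∈ stageInv d :=
  ⟨hp.1.step he, nextStage_le hp.2.1 _, fun _ hj hmj => hp.1.step_eq hp.2.2 he hj hmj⟩

theorem pathLaw_hit_sdiff_le {lam : ℝ} {mu : Fin d → ℝ} (hlam : 0 < lam) (hmu : ∀ i, lam < mu i)
    (hsum : lam + ∑ i, mu i = 1) {κ θ r : ℝ} (h : IsLyapunovParam lam mu κ θ r)
    {V : (Fin d → ℤ) → ℝ} (hV : ∀ x, (∀ i, 0 ≤ x i) → 0 ≤ V x)
    (hdrift : ∀ x, (∀ i, 0 ≤ x i) → x ≠ 0 →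
      mean lam mu (fun e => V (x + constrain x e)) ≤ V x - 1) {x : Fin d → ℤ}
    (hx : ∀ i, 0 ≤ x i) (n : ℕ) :
    pathLaw lam mu {v | tauX x n v < tauX x 0 v ∧ ¬ tauY (T n x) v < ⊤} ≤
      ENNReal.ofReal (2 ^ d / θ ^ d * r ^ n * (1 + κ / 2 * V x)) := by
  obtain ⟨hκ, hθ, hθ1, hr, hr1, -, -⟩ := id h
  -- Normalised so that the last Lyapunov term alone contributes 1 at stage d with total n.
  set c := 2 ^ d / θ ^ d * r ^ n with hc
  have hc0 : 0 < c := by positivity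
  have hreach := pathLaw_reach_le hlam hmu hsum stageStep (stageInv d)
    {p | partialSum p.1 d = n ∧ p.2.2 = d} {p | p.1 ≠ 0}
    (fun p => c * ((1 / 2) ^ p.2.2 * (lyapunov θ r p.2.2 p.1 + κ / 2 * V p.1)))
    (fun p hp => by
      have h1 := hV p.1 hp.1.nonneg
      have h2 := lyapunov_nonneg hθ hr p.2.2 p.1
      positivity)
    (fun p hp hG => by
      have h1 := hV p.1 hp.1.nonneg
      have h2 := le_lyapunov hθ hr d p.1
      rw [hG.1, zpow_neg, zpow_natCast] at h2
      rw [hG.2]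
      have h3 : c * ((1 / 2) ^ d * (θ ^ d * (r ^ n)⁻¹)) = 1 := by
        rw [hc, one_div, inv_pow]
        field_simp
      refine h3.symm.le.trans ?_
      have h4 : 0 ≤ κ / 2 * V p.1 := by positivity
      exact mul_le_mul_of_nonneg_left (mul_le_mul_of_nonneg_left (by linarith) (by positivity))
        hc0.le)
    (fun p hp _ e he => stageStep_mem hp he)
    (fun p hp hp0 => by
      obtain ⟨x, w, m⟩ := p
      obtain ⟨hcp, hm, -⟩ := hp
      have hV0 := hV x hcp.nonneg
      have h1 := mean_lyapunov_le hsum h (isMotion_constrain hcp.nonneg) (nextStage_le hm x)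
      have h2 := mul_le_mul_of_nonneg_left (hdrift x hcp.nonneg hp0) (by positivity : 0 ≤ κ / 2)
      simp only [stageStep, mean_const_mul, mean_add]
      refine mul_le_mul_of_nonneg_left ?_ hc0.le
      refine le_trans (mul_le_mul_of_nonneg_left ?_ (by positivity))
        (lyapunov_nextStage_le hθ hθ1.le hr x m (by positivity : 0 ≤ κ / 2 * V x))
      have h3 : 0 < κ / 2 * (θ ^ nextStage x m * r ^ (-partialSum x (nextStage x m))) := by
        positivity
      linarith)
    (s := (x, x, 0)) ⟨isCoupled_self hx, Nat.zero_le _, fun _ _ _ => rfl⟩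
  have h0 : (1 / 2 : ℝ) ^ 0 * (lyapunov θ r 0 x + κ / 2 * V x) = 1 + κ / 2 * V x := by
    simp [lyapunov]
  simp only [h0] at hreach
  refine (measure_mono_ae ?_).trans hreach
  filter_upwards [ae_jump hlam hmu hsum] with v hv
  rintro ⟨h1, h2⟩
  rw [tauX_lt_iff n hx] at h1
  rw [tauY_lt_top_iff n fun i _ => hx i] at h2
  obtain ⟨k, hk, hk0⟩ := h1
  obtain ⟨hX, hF⟩ := run_stageStep x x 0 k v
  have hmem : run stageStep (x, x, 0) k v ∈ stageInv d :=
    run_mem (fun p hp e he => stageStep_mem hp he)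
      ⟨isCoupled_self hx, Nat.zero_le _, fun _ _ _ => rfl⟩ hv k
  refine ⟨k, ⟨by rw [hX, hk], ?_⟩, fun i hi => ?_⟩
  -- Before stage d the totals agree, so the free walk would also be at level n.
  · by_contra hne
    have := hmem.2.2 d le_rfl (lt_of_le_of_ne hmem.2.1 hne)
    rw [hX, hF, hk] at this
    exact h2 ⟨k, this⟩
  · rw [(run_stageStep x x 0 i v).1]
    exact hk0 i hi.le

/-- The transition of the coupled walks with a flag recording a visit of `X` to the origin. -/
def flagStep (p : (Fin d → ℤ) × (Fin d → ℤ) × Prop) (e : Fin d → ℤ) :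
    (Fin d → ℤ) × (Fin d → ℤ) × Prop :=
  (p.1 + constrain p.1 e, p.2.1 + constrain₁ p.2.1 e, p.2.2 ∨ p.1 = 0)

theorem run_flagStep (x w : Fin d → ℤ) (k : ℕ) (v : ℕ → Fin d → ℤ) :
    run flagStep (x, w, False) k v = (X x k v, freeX w k v, ∃ i < k, X x i v = 0) := by
  induction k with
  | zero => simp [run, X, freeX]
  | succ k ih =>
    rw [run, ih, flagStep]
    refine Prod.ext rfl (Prod.ext rfl (propext ?_))
    simp only [Nat.lt_succ_iff_lt_or_eq]
    grind

theorem X_bounds {x : Fin d → ℤ} (hx : ∀ i, 0 ≤ x i) {v : ℕ → Fin d → ℤ} (hv : ∀ k, Jump (v k))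
    (k : ℕ) : partialSum (X x k v) d - 1 ≤ partialSum (X x (k + 1) v) d ∧
      partialSum (X x (k + 1) v) d ≤ partialSum (X x k v) d + 1 :=
  (isMotion_constrain (X_nonneg hx k v)).partialSum_top_bounds (hv k)

theorem freeX_bounds {w : Fin d → ℤ} (hw : ∀ i, i ≠ 0 → 0 ≤ w i) {v : ℕ → Fin d → ℤ}
    (hv : ∀ k, Jump (v k)) (k : ℕ) :
    partialSum (freeX w k v) d - 1 ≤ partialSum (freeX w (k + 1) v) d :=
  ((isMotion_constrain₁ (freeX_nonneg hw k v)).partialSum_top_bounds (hv k)).1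

theorem isCoupled_run {x : Fin d → ℤ} (hx : ∀ i, 0 ≤ x i) {v : ℕ → Fin d → ℤ}
    (hv : ∀ k, Jump (v k)) (k : ℕ) : IsCoupled (X x k v) (freeX x k v) := by
  induction k with
  | zero => exact isCoupled_self hx
  | succ k ih => exact ih.step (hv k)

open scoped Classical in
theorem pathLaw_free_sdiff_le {lam : ℝ} {mu : Fin d → ℝ} (hlam : 0 < lam) (hmu : ∀ i, lam < mu i)
    (hsum : lam + ∑ i, mu i = 1) {κ θ r : ℝ} (h : IsLyapunovParam lam mu κ θ r) {x : Fin d → ℤ}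
    (hx : ∀ i, 0 ≤ x i) {n : ℕ} (hn : n ≠ 0) (hxn : partialSum x d ≤ n) :
    pathLaw lam mu {v | tauY (T n x) v < ⊤ ∧ ¬ tauX x n v < tauX x 0 v} ≤
      ENNReal.ofReal (1 / θ ^ d * r ^ n * (d + 1)) := by
  obtain ⟨hκ, hθ, hθ1, hr, hr1, -, -⟩ := id h
  set c := 1 / θ ^ d * r ^ n with hc
  have hc0 : 0 < c := by positivity
  have hmean : ∀ w : Fin d → ℤ, (∀ i, i ≠ 0 → 0 ≤ w i) →
      mean lam mu (fun e => lyapunov θ r d (w + constrain₁ w e)) ≤ lyapunov θ r d w := fun w hw =>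
    mean_lyapunov_le_of_service_zero hsum h (isMotion_constrain₁ hw) (by
      rw [constrain₁_service hw, if_pos (Or.inl rfl)])
  have hreach := pathLaw_reach_le hlam hmu hsum flagStep {p | IsCoupled p.1 p.2.1}
    {p | partialSum p.2.1 d = n ∧ p.2.2} Set.univ
    -- Before `X` visits the origin the function is constant; at the visit all partial sums of the
    -- free walk are at most 0, so its Lyapunov value is at most d + 1.
    (fun p => c * (if p.2.2 then lyapunov θ r d p.2.1 else d + 1))
    (fun p hp => by
      have h1 := lyapunov_nonneg hθ hr d p.2.1
      positivity)
    (fun p hp hG => by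
      have h2 := le_lyapunov hθ hr d p.2.1
      rw [hG.1, zpow_neg, zpow_natCast] at h2
      rw [if_pos hG.2]
      have h3 : c * (θ ^ d * (r ^ n)⁻¹) = 1 := by
        rw [hc]
        field_simp
      rw [← h3]
      gcongr)
    (fun p hp _ e he => IsCoupled.step hp he)
    (fun p hp _ => by
      obtain ⟨x, w, b⟩ := p
      have hp : IsCoupled x w := hp
      simp only [flagStep, mean_const_mul]
      refine mul_le_mul_of_nonneg_left ?_ hc0.le
      by_cases hb : b
      · simp only [hb, true_or, if_true]
        exact hmean w hp.nonneg_free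
      · by_cases hx0 : x = 0
        · simp only [hb, hx0, false_or, if_true, if_false]
          refine (hmean w hp.nonneg_free).trans ?_
          have h1 := lyapunov_le (m := d) (x := w) (n := 0) hθ hθ1.le hr hr1 fun j hj => by
            have := hp.le j hj
            rwa [hx0, partialSum_zero_left] at this
          simpa using h1
        · simp only [hb, hx0, or_self, if_false]
          exact (mean_const hsum _).le)
    (s := (x, x, False)) (isCoupled_self hx)
  simp only [if_false] at hreach
  refine (measure_mono_ae ?_).trans hreach
  filter_upwards [ae_jump hlam hmu hsum] with v hv
  rintro ⟨h1, h2⟩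
  rw [tauX_lt_iff n hx] at h2
  rw [tauY_lt_top_iff n fun i _ => hx i] at h1
  obtain ⟨k, hk⟩ := h1
  refine ⟨k, ?_, fun i _ => Set.mem_univ _⟩
  rw [run_flagStep]
  refine ⟨hk, ?_⟩
  -- If `X` has not met the origin before time k, its total, which dominates that of the free walk
  -- and rises by at most one per step, has already passed level n.
  by_contra hne
  simp only [not_exists, not_and] at hne
  have hle := (isCoupled_run hx hv k).le d le_rfl
  rw [hk] at hle
  obtain ⟨j, hj, hjn⟩ := exists_eq_of_le_add_one (a := fun k => partialSum (X x k v) d)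
    (fun k => (X_bounds hx hv k).2) hxn hle
  refine h2 ⟨j, hjn, fun i hi => ?_⟩
  rcases hi.lt_or_eq with hij | rfl
  · exact hne i (by omega)
  · exact partialSum_top_ne_zero hn hjn

/-- The absolute error of the approximation. -/
theorem exists_abs_probX_sub_probY_le {lam : ℝ} {mu : Fin d → ℝ} (hlam : 0 < lam)
    (hmu : ∀ i, lam < mu i) (hsum : lam + ∑ i, mu i = 1) {q r r₀ : ℝ} (hq : 0 < q)
    (hqmu : ∀ i, lam / q ≤ mu i) (hqr : q < r) (hr1 : r < 1) (hqr₀ : q < r₀) (hr₀1 : r₀ < 1) :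
    ∃ C : ℝ, 0 < C ∧ ∀ n : ℕ, n ≠ 0 → ∀ x : Fin d → ℤ, (∀ i, 0 ≤ x i) → partialSum x d ≤ n →
      |probX lam mu n x - probY lam mu (T n x)| ≤ C * (r ^ n * r₀ ^ (-(n : ℤ))) := by
  have := isProbabilityMeasure_pathLaw hlam hmu hsum
  obtain ⟨κ, θ, hp⟩ := exists_isLyapunovParam (mu := mu) hlam hq hqmu hqr hr1
  obtain ⟨V, C, hC, hV, hdrift, hVC⟩ := exists_drift_le_neg_one hlam hsum hq hqmu hqr₀ hr₀1
  obtain ⟨hκ, hθ, -, hr, -, -, -⟩ := id hp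
  have hr₀ : 0 < r₀ := hq.trans hqr₀
  refine ⟨2 ^ d / θ ^ d * (1 + κ / 2 * C) + 1 / θ ^ d * (d + 1), by positivity,
    fun n hn x hx hxn => ?_⟩
  have hone : (1 : ℝ) ≤ r₀ ^ (-(n : ℤ)) := by
    rw [zpow_neg, zpow_natCast, one_le_inv₀ (by positivity)]
    exact pow_le_one₀ hr₀.le hr₀1.le
  have hV0 := hV x hx
  have h1 := measureReal_le_add_of_sdiff_le (P := pathLaw lam mu)
    (A := {v | tauX x n v < tauX x 0 v}) (B := {v | tauY (T n x) v < ⊤}) (by positivity)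
    (pathLaw_hit_sdiff_le hlam hmu hsum hp hV hdrift hx n)
  have h2 := measureReal_le_add_of_sdiff_le (P := pathLaw lam mu)
    (A := {v | tauY (T n x) v < ⊤}) (B := {v | tauX x n v < tauX x 0 v}) (by positivity)
    (pathLaw_free_sdiff_le hlam hmu hsum hp hx hn hxn)
  have h3 : 2 ^ d / θ ^ d * r ^ n * (1 + κ / 2 * V x) ≤
      2 ^ d / θ ^ d * r ^ n * ((1 + κ / 2 * C) * r₀ ^ (-(n : ℤ))) := by
    refine mul_le_mul_of_nonneg_left ?_ (by positivity)
    have := mul_le_mul_of_nonneg_left (hVC x hx n hxn) (by positivity : 0 ≤ κ / 2)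
    linarith
  have h4 : 1 / θ ^ d * r ^ n * (d + 1) * 1 ≤ 1 / θ ^ d * r ^ n * (d + 1) * r₀ ^ (-(n : ℤ)) :=
    mul_le_mul_of_nonneg_left hone (by positivity)
  have h5 : 0 ≤ 2 ^ d / θ ^ d * r ^ n * ((1 + κ / 2 * C) * r₀ ^ (-(n : ℤ))) := by positivity
  have h6 : 0 ≤ 1 / θ ^ d * r ^ n * (d + 1) * r₀ ^ (-(n : ℤ)) := by positivity
  rw [abs_le, probX, probY]
  constructor <;> nlinarith

/-- On its way to the origin the total of `X` must pass level n. When `X` is at the origin the total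
of the free walk is at most 0, so it has passed level n too. -/
theorem probX_eq_one_and_probY_eq_one {lam : ℝ} {mu : Fin d → ℝ} (hlam : 0 < lam)
    (hmu : ∀ i, lam < mu i) (hsum : lam + ∑ i, mu i = 1) {x : Fin d → ℤ} (hx : ∀ i, 0 ≤ x i)
    (hret : ∀ᵐ v ∂pathLaw lam mu, ∃ k, X x k v = 0) {n : ℕ} (hn : n ≠ 0)
    (hxn : n ≤ partialSum x d) :
    probX lam mu n x = 1 ∧ probY lam mu (T n x) = 1 := by
  have := isProbabilityMeasure_pathLaw hlam hmu hsum
  have hX : ∀ᵐ v ∂pathLaw lam mu, v ∈ {v | tauX x n v < tauX x 0 v} := by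
    filter_upwards [ae_jump hlam hmu hsum, hret] with v hv hret
    classical
    have ht := Nat.find_spec hret
    have hmin := fun j => @Nat.find_min _ _ hret j
    set t := Nat.find hret
    obtain ⟨k, hk, hkn⟩ := exists_eq_of_ge_sub_one (a := fun k => partialSum (X x k v) d) (t := t)
      (fun k => (X_bounds hx hv k).1) hxn (by simp [ht])
    refine (tauX_lt_iff n hx v).2 ⟨k, hkn, fun i hi => ?_⟩
    rcases hi.lt_or_eq with hik | rfl
    · exact hmin i (by omega)
    · exact partialSum_top_ne_zero hn hkn
  have hY : ∀ᵐ v ∂pathLaw lam mu, v ∈ {v | tauY (T n x) v < ⊤} := by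
    filter_upwards [ae_jump hlam hmu hsum, hret] with v hv hret
    obtain ⟨t, ht⟩ := hret
    have hle := (isCoupled_run hx hv t).le d le_rfl
    rw [ht, partialSum_zero_left] at hle
    obtain ⟨k, -, hkn⟩ := exists_eq_of_ge_sub_one (a := fun k => partialSum (freeX x k v) d)
      (t := t) (fun k => freeX_bounds (fun i _ => hx i) hv k) hxn (by omega)
    exact (tauY_lt_top_iff n (fun i _ => hx i) v).2 ⟨k, hkn⟩
  constructor
  · exact (measureReal_congr (eventuallyEq_univ.2 hX)).trans probReal_univ
  · exact (measureReal_congr (eventuallyEq_univ.2 hY)).trans probReal_univ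

theorem le_probX {lam : ℝ} {mu : Fin d → ℝ} (hlam : 0 < lam) (hmu : ∀ i, lam < mu i)
    (hsum : lam + ∑ i, mu i = 1) {x : Fin d → ℤ} (hx : ∀ i, 0 ≤ x i)
    (hret : ∀ᵐ v ∂pathLaw lam mu, ∃ k, X x k v = 0) {n : ℕ} (hxn : partialSum x d ≤ n)
    (i : Fin d) :
    rhoAt lam mu i ^ n * (rhoAt lam mu i ^ (-partialSum x (i + 1)) - 1) ≤ probX lam mu n x := by
  have := isProbabilityMeasure_pathLaw hlam hmu hsum
  have hmui : 0 < mu i := hlam.trans (hmu i)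
  have hdef : rhoAt lam mu i = lam / mu i := rfl
  set r := rhoAt lam mu i with hr
  have hr0 : 0 < r := div_pos hlam hmui
  have hr1 : r < 1 := (div_lt_one hmui).2 (hmu i)
  have hbal : lam * (1 / r - 1) - mu i * (1 - r) = 0 := by
    rw [hdef]
    field_simp
    ring
  have hbnd : ∀ y : Fin d → ℤ, (∀ i, 0 ≤ y i) → partialSum y d ≤ n →
      r ^ n * r ^ (-partialSum y (i + 1)) ≤ 1 := by
    intro y hy hyn
    have h1 : partialSum y (i + 1) ≤ n := (partialSum_mono hy i.2).trans hyn
    rw [← zpow_natCast, ← zpow_add₀ hr0.ne']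
    exact zpow_le_one₀ hr0 hr1.le (by omega)
  have hpos : ∀ y : Fin d → ℤ, (∀ i, 0 ≤ y i) → partialSum y d ≤ n →
      0 ≤ 1 + r ^ n + -r ^ n * r ^ (-partialSum y (i + 1)) := by
    intro y hy hyn
    have h1 := hbnd y hy hyn
    have h2 : 0 < r ^ n := by positivity
    linarith
  have hreach := pathLaw_reach_le hlam hmu hsum (fun x e => x + constrain x e)
    {x | (∀ i, 0 ≤ x i) ∧ partialSum x d ≤ n} {0} {x | partialSum x d ≠ n}
    -- For r = ρ_i the power is a martingale while node i can serve and a submartingale when it is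
    -- blocked. This function is therefore a supermartingale; it equals 1 at the origin and is
    -- nonnegative up to total n, so it bounds the probability of reaching the origin first.
    (fun x => 1 + r ^ n + -r ^ n * r ^ (-partialSum x (i + 1)))
    (fun y hy => hpos y hy.1 hy.2)
    (fun y _ hy0 => by
      rw [Set.mem_singleton_iff.1 hy0]
      simp)
    (fun y hy hyA e he => by
      refine ⟨add_constrain_nonneg hy.1 e, ?_⟩
      have h1 := ((isMotion_constrain hy.1).partialSum_top_bounds he).2
      have h2 := lt_of_le_of_ne hy.2 hyA
      omega)
    (fun y hy _ => by
      simp only [mean_add, mean_const_mul, mean_const hsum]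
      have hrn : 0 < r ^ n := by positivity
      have hz : 0 < r ^ (-partialSum y (i + 1)) := by positivity
      have h1 : 0 ≤ mean lam mu (fun e => r ^ (-partialSum (y + constrain y e) (i + 1))) -
          r ^ (-partialSum y (i + 1)) := by
        rcases mean_zpow_partialSum hsum hr0 (isMotion_constrain hy.1) i with ⟨-, he⟩ | ⟨-, -, he⟩
        · rw [he, hbal, zero_mul]
        · rw [he]
          have : 0 ≤ 1 / r - 1 := sub_nonneg.2 (one_lt_one_div hr0 hr1).le
          positivity
      nlinarith)
    (s := x) ⟨hx, hxn⟩
  have hcompl : pathLaw lam mu (Set.univ \ {v | tauX x n v < tauX x 0 v}) ≤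
      ENNReal.ofReal (1 + r ^ n + -r ^ n * r ^ (-partialSum x (i + 1))) := by
    refine (measure_mono_ae ?_).trans hreach
    filter_upwards [hret] with v hret
    rintro ⟨-, hv⟩
    rw [Set.mem_ofPred_eq, tauX_lt_iff n hx] at hv
    classical
    have ht := Nat.find_spec hret
    have hmin := fun j => @Nat.find_min _ _ hret j
    set t := Nat.find hret
    refine ⟨t, by rwa [← X_eq_run], fun k hk => ?_⟩
    rw [← X_eq_run]
    exact fun hkn => hv ⟨k, hkn, fun i hi => hmin i (by omega)⟩
  have h1 := measureReal_le_add_of_sdiff_le (hpos x hx hxn) hcompl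
  rw [probReal_univ] at h1
  rw [probX]
  linarith

end Estimates

/-! ### Exponential rates and the relative error. -/

section Rates

variable {d : ℕ} {lam : ℝ} {mu : Fin d → ℝ}

theorem rhoAt_pos (hlam : 0 < lam) (hmu : ∀ i, lam < mu i) (i : Fin d) : 0 < rhoAt lam mu i :=
  div_pos hlam (hlam.trans (hmu i))

theorem rhoAt_le_rho (i : Fin d) : rhoAt lam mu i ≤ rho lam mu :=
  le_ciSup (Set.finite_range _).bddAbove i

theorem log_rho_div_log_rhoAt (i : Fin d) :
    Real.log (rho lam mu) / Real.log (rhoAt lam mu i) =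
      (Real.logb (rho lam mu) (rhoAt lam mu i))⁻¹ := by
  rw [Real.logb, inv_div]

theorem g_le (x : Fin d → ℝ) (i : Fin d) :
    g lam mu x ≤ (1 - ∑ j ∈ Finset.Iic i, x j) * Real.logb (rho lam mu) (rhoAt lam mu i) :=
  ciInf_le (Set.finite_range _).bddBelow i

theorem mul_g_term (x : Fin d → ℤ) {n : ℕ} (hn : n ≠ 0) (i : Fin d) (c : ℝ) :
    (n : ℝ) * ((1 - ∑ j ∈ Finset.Iic i, (x j : ℝ) / n) * c) =
      c * ((n : ℝ) - partialSum x (i + 1)) := by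
  have hn' : (n : ℝ) ≠ 0 := Nat.cast_ne_zero.2 hn
  rw [partialSum_succ_eq_sum_Iic, ← Finset.sum_div]
  push_cast
  field_simp

theorem exists_lt_partialSum_of_notMem_R {x : Fin d → ℝ} (hx : x ∈ simplexA d \ R lam mu) :
    ∃ i, 1 - Real.log (rho lam mu) / Real.log (rhoAt lam mu i) < ∑ j ∈ Finset.Iic i, x j := by
  by_contra! h
  exact hx.2 ⟨hx.1.1, h⟩

theorem tendsto_sum_Iic {u : ℕ → Fin d → ℤ} {x : Fin d → ℝ}
    (hu : Tendsto (fun (n : ℕ) (i : Fin d) => (u n i : ℝ) / (n : ℝ)) atTop (𝓝 x)) (i : Fin d) :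
    Tendsto (fun n : ℕ => ∑ j ∈ Finset.Iic i, (u n j : ℝ) / (n : ℝ)) atTop
      (𝓝 (∑ j ∈ Finset.Iic i, x j)) :=
  tendsto_finsetSum _ fun j _ => tendsto_pi_nhds.1 hu j

theorem eventually_mem_Rbar {u : ℕ → Fin d → ℤ} {x : Fin d → ℝ} (hu0 : ∀ n i, 0 ≤ u n i)
    (hx : x ∈ simplexA d \ R lam mu)
    (hu : Tendsto (fun (n : ℕ) (i : Fin d) => (u n i : ℝ) / (n : ℝ)) atTop (𝓝 x)) :
    ∀ᶠ n : ℕ in atTop, u n ∈ Rbar lam mu n := by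
  obtain ⟨i, hi⟩ := exists_lt_partialSum_of_notMem_R hx
  set a := 1 - Real.log (rho lam mu) / Real.log (rhoAt lam mu i)
  have h1 : Tendsto (fun n : ℕ => ∑ j ∈ Finset.Iic i, (u n j : ℝ) / (n : ℝ) - 1 / (n : ℝ)) atTop
      -- The term 1 / n makes room for the summand 1 in `Rbar`; the strict inequality outside `R`
      -- leaves it.
      (𝓝 (∑ j ∈ Finset.Iic i, x j - 0)) :=
    (tendsto_sum_Iic hu i).sub tendsto_one_div_atTop_nhds_zero_nat
  rw [sub_zero] at h1
  filter_upwards [h1.eventually (lt_mem_nhds hi), eventually_gt_atTop 0] with n hn hn0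
  refine ⟨hu0 n, i, ?_⟩
  have hn' : (0 : ℝ) < n := Nat.cast_pos.2 hn0
  rw [← Finset.sum_div, ← sub_div, lt_div_iff₀ hn'] at hn
  linarith

variable [NeZero d]

theorem rho_pos (hlam : 0 < lam) (hmu : ∀ i, lam < mu i) : 0 < rho lam mu :=
  (rhoAt_pos hlam hmu 0).trans_le (rhoAt_le_rho 0)

theorem rho_lt_one (hlam : 0 < lam) (hmu : ∀ i, lam < mu i) : rho lam mu < 1 := by
  obtain ⟨i, hi⟩ := exists_eq_ciSup_of_finite (f := rhoAt lam mu)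
  rw [rho, ← hi]
  exact (div_lt_one (hlam.trans (hmu i))).2 (hmu i)

theorem lam_div_rho_le (hlam : 0 < lam) (hmu : ∀ i, lam < mu i) (i : Fin d) :
    lam / rho lam mu ≤ mu i := by
  have h := rhoAt_le_rho (lam := lam) (mu := mu) i
  rw [rhoAt, div_le_iff₀ (hlam.trans (hmu i))] at h
  rw [div_le_iff₀ (rho_pos hlam hmu)]
  linarith

theorem logb_rho_rhoAt_pos (hlam : 0 < lam) (hmu : ∀ i, lam < mu i) (i : Fin d) :
    0 < Real.logb (rho lam mu) (rhoAt lam mu i) :=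
  Real.logb_pos_of_base_lt_one (rho_pos hlam hmu) (rho_lt_one hlam hmu) (rhoAt_pos hlam hmu i)
    ((rhoAt_le_rho i).trans_lt (rho_lt_one hlam hmu))

theorem one_le_logb_rho_rhoAt (hlam : 0 < lam) (hmu : ∀ i, lam < mu i) (i : Fin d) :
    1 ≤ Real.logb (rho lam mu) (rhoAt lam mu i) := by
  have h0 := rho_pos hlam hmu
  have h1 := rho_lt_one hlam hmu
  rw [← Real.logb_self_eq_one_iff.2 ⟨h0.ne', h1.ne, by linarith⟩]
  exact (Real.logb_le_logb_of_base_lt_one h0 h1 h0 (rhoAt_pos hlam hmu i)).2 (rhoAt_le_rho i)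

/-- The lower bound on `ℙ_x(τ_n < τ_0)`. -/
theorem rho_rpow_le_probX (hlam : 0 < lam) (hmu : ∀ i, lam < mu i) (hsum : lam + ∑ i, mu i = 1)
    {x : Fin d → ℤ} {n : ℕ} (hn : n ≠ 0) (hx : x ∈ Rbar lam mu n)
    (hret : ∀ᵐ v ∂pathLaw lam mu, ∃ k, X x k v = 0) (hxn : partialSum x d ≤ n) :
    (1 - rho lam mu) * rho lam mu ^ ((n : ℝ) * g lam mu (fun i => (x i : ℝ) / n)) ≤
      probX lam mu n x := by
  have h0 := rho_pos hlam hmu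
  have h1 := rho_lt_one hlam hmu
  have hn0 : (0 : ℝ) < n := Nat.cast_pos.2 (Nat.pos_of_ne_zero hn)
  obtain ⟨i, hi⟩ := exists_eq_ciInf_of_finite (f := fun i : Fin d =>
    (1 - ∑ j ∈ Finset.Iic i, (x j : ℝ) / n) * Real.logb (rho lam mu) (rhoAt lam mu i))
  have hgi : (n : ℝ) * g lam mu (fun i => (x i : ℝ) / n) =
      Real.logb (rho lam mu) (rhoAt lam mu i) * ((n : ℝ) - partialSum x (i + 1)) := by
    rw [g, ← hi]
    exact mul_g_term x hn i _
  -- The summand 1 in `Rbar` makes the inequality strict. Since every log_ρ ρ_i is at least 1, it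
  -- forces the partial sum at the minimising index to be positive.
  have hlt : (n : ℝ) * g lam mu (fun i => (x i : ℝ) / n) < n := by
    obtain ⟨hx0, k, hk⟩ := hx
    have hg := mul_le_mul_of_nonneg_left
      (g_le (lam := lam) (mu := mu) (fun i => (x i : ℝ) / n) k) hn0.le
    rw [mul_g_term x hn k] at hg
    have hL := logb_rho_rhoAt_pos hlam hmu k
    rw [log_rho_div_log_rhoAt] at hk
    have hk' : 1 + (n : ℝ) * (1 - (Real.logb (rho lam mu) (rhoAt lam mu k))⁻¹) ≤
        partialSum x (k + 1) := by
      rw [partialSum_succ_eq_sum_Iic]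
      exact_mod_cast hk
    have h2 := mul_le_mul_of_nonneg_left hk' hL.le
    have h3 : Real.logb (rho lam mu) (rhoAt lam mu k) *
        (1 + (n : ℝ) * (1 - (Real.logb (rho lam mu) (rhoAt lam mu k))⁻¹)) =
        Real.logb (rho lam mu) (rhoAt lam mu k) * (1 + n) - n := by
      field_simp
      ring
    rw [h3] at h2
    nlinarith
  have hS : 1 ≤ partialSum x (i + 1) := by
    by_contra hS
    have hS' : partialSum x (i + 1) ≤ 0 := by omega
    have hS'' : (partialSum x (i + 1) : ℝ) ≤ 0 := by exact_mod_cast hS'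
    have hL := one_le_logb_rho_rhoAt hlam hmu i
    rw [hgi] at hlt
    nlinarith
  have hr0 := rhoAt_pos hlam hmu i
  have hr1 := rhoAt_le_rho (lam := lam) (mu := mu) i
  have hlow := le_probX hlam hmu hsum hx.1 hret hxn i
  set r := rhoAt lam mu i
  have hpow : rho lam mu ^ ((n : ℝ) * g lam mu (fun i => (x i : ℝ) / n)) =
      r ^ n * r ^ (-partialSum x (i + 1)) := by
    rw [hgi, Real.rpow_mul h0.le, Real.rpow_logb h0 h1.ne hr0, sub_eq_add_neg,
      Real.rpow_add hr0, Real.rpow_natCast]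
    congr 1
    rw [← Real.rpow_intCast]
    push_cast
    rfl
  -- Hence r^{-S} - 1 ≥ (1 - r) r^{-S} ≥ (1 - ρ) r^{-S}, which absorbs the -1 of `le_probX` into a
  -- constant factor.
  have hz : 1 ≤ r * r ^ (-partialSum x (i + 1)) := by
    rw [← zpow_one_add₀ hr0.ne']
    exact one_le_zpow_of_nonpos₀ hr0 (hr1.trans h1.le) (by omega)
  rw [hpow]
  refine le_trans ?_ hlow
  have hrn : 0 < r ^ n := by positivity
  have hz0 : 0 < r ^ (-partialSum x (i + 1)) := by positivity
  have h4 : (1 - rho lam mu) * r ^ (-partialSum x (i + 1)) ≤ r ^ (-partialSum x (i + 1)) - 1 := by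
    nlinarith
  nlinarith [mul_le_mul_of_nonneg_left h4 hrn.le]

/-- The uniform bound on the relative error. -/
theorem exists_forall_relErr_le (hlam : 0 < lam) (hsum : lam + ∑ i, mu i = 1)
    (hmu : ∀ i, lam < mu i) {ε : ℝ} (hε : 0 < ε) :
    ∃ n₀ : ℕ, 0 < n₀ ∧ ∀ n : ℕ, n₀ < n → ∀ x ∈ Rbar lam mu n,
      0 < probX lam mu n x ∧ relErr lam mu n x ≤
        rho lam mu ^ ((n : ℝ) * (1 - g lam mu (fun i => (x i : ℝ) / (n : ℝ)) - ε)) := by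
  have h0 := rho_pos hlam hmu
  have h1 := rho_lt_one hlam hmu
  have hq := lam_div_rho_le hlam hmu
  set ρ := rho lam mu with hρ
  -- One δ is lost in taking r above ρ, one in the growth of V, and one absorbs the constant C / (1
  -- - ρ) for large n.
  obtain ⟨δ, hδ0, hδ1, hδε⟩ : ∃ δ : ℝ, 0 < δ ∧ δ < 1 ∧ 3 * δ ≤ ε :=
    ⟨min ε 1 / 3, by positivity, by linarith [min_le_right ε 1], by linarith [min_le_left ε 1]⟩
  have hr : ρ < ρ ^ (1 - δ) := Real.self_lt_rpow_of_lt_one h0 h1 (by linarith)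
  have hr' : ρ ^ (1 - δ) < 1 := Real.rpow_lt_one h0.le h1 (by linarith)
  have hr₀ : ρ < ρ ^ δ := Real.self_lt_rpow_of_lt_one h0 h1 hδ1
  have hr₀' : ρ ^ δ < 1 := Real.rpow_lt_one h0.le h1 hδ0
  obtain ⟨C, hC, hbound⟩ := exists_abs_probX_sub_probY_le hlam hmu hsum h0 hq hr hr' hr₀ hr₀'
  obtain ⟨V, -, -, hV, hdrift, -⟩ := exists_drift_le_neg_one hlam hsum h0 hq hr₀ hr₀'
  obtain ⟨n₀, hn₀⟩ := exists_pow_lt_of_lt_one (show 0 < (1 - ρ) / C by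
    have : 0 < 1 - ρ := by linarith
    positivity) hr₀'
  refine ⟨n₀ + 1, Nat.succ_pos _, fun n hn x hx => ?_⟩
  have hn0 : n ≠ 0 := by omega
  have hret := ae_exists_X_eq_zero hlam hmu hsum hV hdrift hx.1
  rcases le_total (n : ℤ) (partialSum x d) with hxn | hxn
  · obtain ⟨hX, hY⟩ := probX_eq_one_and_probY_eq_one hlam hmu hsum hx.1 hret hn0 hxn
    rw [relErr, hX, hY, sub_self, abs_zero, zero_div]
    exact ⟨one_pos, Real.rpow_nonneg h0.le _⟩
  have hlow := rho_rpow_le_probX hlam hmu hsum hn0 hx hret hxn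
  have hb := hbound n hn0 x hx.1 hxn
  set γ := g lam mu (fun i => (x i : ℝ) / (n : ℝ))
  have hγ : 0 < ρ ^ ((n : ℝ) * γ) := Real.rpow_pos_of_pos h0 _
  have hpos : 0 < probX lam mu n x :=
    lt_of_lt_of_le (mul_pos (by linarith) hγ) hlow
  refine ⟨hpos, ?_⟩
  rw [relErr, div_le_iff₀ hpos]
  have e1 : (ρ ^ (1 - δ)) ^ n * (ρ ^ δ) ^ (-(n : ℤ)) = ρ ^ ((n : ℝ) * (1 - 2 * δ)) := by
    rw [zpow_neg, zpow_natCast, ← Real.rpow_mul_natCast h0.le, ← Real.rpow_mul_natCast h0.le,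
      ← Real.rpow_neg h0.le, ← Real.rpow_add h0]
    congr 1
    ring
  have e2 : C * (ρ ^ δ) ^ n ≤ 1 - ρ := by
    have h2 : (ρ ^ δ) ^ n ≤ (ρ ^ δ) ^ n₀ :=
      pow_le_pow_of_le_one (Real.rpow_nonneg h0.le _) hr₀'.le (by omega)
    have h3 := h2.trans hn₀.le
    rw [le_div_iff₀ hC] at h3
    linarith
  have e3 : ρ ^ ((n : ℝ) * (1 - 2 * δ)) =
      (ρ ^ δ) ^ n * (ρ ^ ((n : ℝ) * (1 - γ - 3 * δ)) * ρ ^ ((n : ℝ) * γ)) := by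
    rw [← Real.rpow_mul_natCast h0.le, ← Real.rpow_add h0, ← Real.rpow_add h0]
    congr 1
    ring
  have e4 : ρ ^ ((n : ℝ) * (1 - γ - 3 * δ)) ≤ ρ ^ ((n : ℝ) * (1 - γ - ε)) :=
    Real.rpow_le_rpow_of_exponent_ge h0 h1.le (by gcongr)
  have hz : 0 < ρ ^ ((n : ℝ) * (1 - γ - 3 * δ)) := Real.rpow_pos_of_pos h0 _
  calc |probX lam mu n x - probY lam mu (T n x)|
      ≤ C * ρ ^ ((n : ℝ) * (1 - 2 * δ)) := by rwa [e1] at hb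
    _ = (C * (ρ ^ δ) ^ n) * (ρ ^ ((n : ℝ) * (1 - γ - 3 * δ)) * ρ ^ ((n : ℝ) * γ)) := by
        rw [e3]; ring
    _ ≤ (1 - ρ) * (ρ ^ ((n : ℝ) * (1 - γ - 3 * δ)) * ρ ^ ((n : ℝ) * γ)) :=
        mul_le_mul_of_nonneg_right e2 (by positivity)
    _ = ρ ^ ((n : ℝ) * (1 - γ - 3 * δ)) * ((1 - ρ) * ρ ^ ((n : ℝ) * γ)) := by ring
    _ ≤ ρ ^ ((n : ℝ) * (1 - γ - ε)) * probX lam mu n x :=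
        mul_le_mul e4 hlow (mul_nonneg (by linarith) hγ.le) (Real.rpow_nonneg h0.le _)

theorem g_lt_one (hlam : 0 < lam) (hmu : ∀ i, lam < mu i) {x : Fin d → ℝ}
    (hx : x ∈ simplexA d \ R lam mu) : g lam mu x < 1 := by
  obtain ⟨i, hi⟩ := exists_lt_partialSum_of_notMem_R hx
  refine (g_le x i).trans_lt ?_
  have hL := logb_rho_rhoAt_pos hlam hmu i
  rw [log_rho_div_log_rhoAt] at hi
  rw [← lt_div_iff₀ hL, one_div]
  linarith

/-- An infimum is bounded above by any one term, so it is enough to follow the index that is minimal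
at the limit point. -/
theorem eventually_g_le {u : ℕ → Fin d → ℤ} {x : Fin d → ℝ}
    (hu : Tendsto (fun (n : ℕ) (i : Fin d) => (u n i : ℝ) / (n : ℝ)) atTop (𝓝 x)) {ε : ℝ}
    (hε : 0 < ε) :
    ∀ᶠ n : ℕ in atTop, g lam mu (fun i => (u n i : ℝ) / (n : ℝ)) ≤ g lam mu x + ε := by
  obtain ⟨i, hi⟩ := exists_eq_ciInf_of_finite (f := fun i : Fin d =>
    (1 - ∑ j ∈ Finset.Iic i, x j) * Real.logb (rho lam mu) (rhoAt lam mu i))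
  have h1 := ((tendsto_sum_Iic hu i).const_sub 1).mul_const
    (Real.logb (rho lam mu) (rhoAt lam mu i))
  have h2 : (1 - ∑ j ∈ Finset.Iic i, x j) * Real.logb (rho lam mu) (rhoAt lam mu i) <
      g lam mu x + ε := by
    rw [g, ← hi]
    linarith
  filter_upwards [h1.eventually (gt_mem_nhds h2)] with n hn
  exact (g_le _ i).trans hn.le

/-- Working in `EReal` covers a vanishing relative error: its logarithm is ⊥, and the negative
factor turns it into ⊤. -/
theorem le_neg_inv_mul_log {a c : ℝ} {n : ℕ} (hn : n ≠ 0) (ha : a ≤ Real.exp (-((n : ℝ) * c))) :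
    (c : EReal) ≤ ((-(1 / (n : ℝ)) : ℝ) : EReal) * ENNReal.log (ENNReal.ofReal a) := by
  have hn' : (0 : ℝ) < n := Nat.cast_pos.2 (Nat.pos_of_ne_zero hn)
  have h1 : ENNReal.log (ENNReal.ofReal a) ≤ ((-((n : ℝ) * c) : ℝ) : EReal) := by
    calc ENNReal.log (ENNReal.ofReal a)
        ≤ ENNReal.log (ENNReal.ofReal (Real.exp (-((n : ℝ) * c)))) :=
          ENNReal.log_le_log (ENNReal.ofReal_le_ofReal ha)
      _ = _ := by rw [ENNReal.log_ofReal_of_pos (Real.exp_pos _), Real.log_exp]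
  have h2 : ((-(1 / (n : ℝ)) : ℝ) : EReal) ≤ 0 := by
    rw [EReal.coe_nonpos]
    have : 0 < 1 / (n : ℝ) := by positivity
    linarith
  have h3 := EReal.mul_le_mul_of_nonpos_right h1 h2
  rw [← EReal.coe_mul, mul_comm (ENNReal.log _)] at h3
  refine le_trans (le_of_eq ?_) h3
  congr 1
  field_simp

theorem le_liminf_relErr (hlam : 0 < lam) (hsum : lam + ∑ i, mu i = 1) (hmu : ∀ i, lam < mu i)
    {u : ℕ → Fin d → ℤ} {x : Fin d → ℝ} (hu0 : ∀ n i, 0 ≤ u n i)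
    (hx : x ∈ simplexA d \ R lam mu)
    (hu : Tendsto (fun (n : ℕ) (i : Fin d) => (u n i : ℝ) / (n : ℝ)) atTop (𝓝 x)) :
    ((-Real.log (rho lam mu) * (1 - g lam mu x) : ℝ) : EReal) ≤
      liminf (fun n : ℕ => ((-(1 / (n : ℝ)) : ℝ) : EReal) *
        ENNReal.log (ENNReal.ofReal (relErr lam mu n (u n)))) atTop := by
  have h0 := rho_pos hlam hmu
  have h1 := rho_lt_one hlam hmu
  have hlog : 0 < -Real.log (rho lam mu) := neg_pos.2 (Real.log_neg h0 h1)
  refine le_of_forall_lt_imp_le_of_dense fun a ha => ?_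
  obtain ⟨c, hac, hc⟩ := EReal.lt_iff_exists_real_btwn.1 ha
  rw [EReal.coe_lt_coe_iff] at hc
  refine hac.le.trans ?_
  set l := -Real.log (rho lam mu) with hl
  -- The gap to c is split in two: one ε for the fluctuation of `g` along the sequence, one for the
  -- error bound.
  obtain ⟨ε, hε, hεc⟩ : ∃ ε : ℝ, 0 < ε ∧ l * (1 - (g lam mu x + ε) - ε) = c := by
    refine ⟨(l * (1 - g lam mu x) - c) / (2 * l), div_pos (by linarith) (by linarith), ?_⟩
    field_simp
    ring
  obtain ⟨n₀, -, hn₀⟩ := exists_forall_relErr_le hlam hsum hmu hε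
  refine le_liminf_of_le (by isBoundedDefault) ?_
  filter_upwards [eventually_gt_atTop n₀, eventually_mem_Rbar hu0 hx hu,
    eventually_g_le (lam := lam) (mu := mu) hu hε] with n hn hmem hg
  refine le_neg_inv_mul_log (by omega) ((hn₀ n hn _ hmem).2.trans ?_)
  rw [Real.rpow_def_of_pos h0, Real.exp_le_exp, ← hεc]
  have h2 : l * (1 - (g lam mu x + ε) - ε) ≤
      l * (1 - g lam mu (fun i => (u n i : ℝ) / (n : ℝ)) - ε) :=
    mul_le_mul_of_nonneg_left (by linarith) hlog.le
  have h3 := mul_le_mul_of_nonneg_left h2 (Nat.cast_nonneg (α := ℝ) n)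
  have h4 : Real.log (rho lam mu) = -l := by rw [hl, neg_neg]
  rw [h4]
  linarith

end Rates

end

end Tandem

theorem theorem1 {d : ℕ} [NeZero d] (lam : ℝ) (mu : Fin d → ℝ) (hlam : 0 < lam)
    (hsum : lam + ∑ i, mu i = 1) (hstable : ∀ i, lam < mu i) :
    (∀ ε : ℝ, 0 < ε → ∃ n₀ : ℕ, 0 < n₀ ∧ ∀ n : ℕ, n₀ < n → ∀ x ∈ Tandem.Rbar lam mu n,
      0 < Tandem.probX lam mu n x ∧
      Tandem.relErr lam mu n x ≤
        Tandem.rho lam mu ^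
          ((n : ℝ) * (1 - Tandem.g lam mu (fun i => (x i : ℝ) / (n : ℝ)) - ε))) ∧
    (∀ (u : ℕ → Fin d → ℤ) (x : Fin d → ℝ), (∀ n i, 0 ≤ u n i) →
      x ∈ Tandem.simplexA d \ Tandem.R lam mu →
      Tendsto (fun (n : ℕ) (i : Fin d) => (u n i : ℝ) / (n : ℝ)) atTop (𝓝 x) →
      0 < -Real.log (Tandem.rho lam mu) * (1 - Tandem.g lam mu x) ∧
      (∀ᶠ n : ℕ in atTop, 0 < Tandem.probX lam mu n (u n)) ∧
      ((-Real.log (Tandem.rho lam mu) * (1 - Tandem.g lam mu x) : ℝ) : EReal) ≤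
        liminf (fun n : ℕ => ((-(1 / (n : ℝ)) : ℝ) : EReal) *
          ENNReal.log (ENNReal.ofReal (Tandem.relErr lam mu n (u n)))) atTop) := by
  refine ⟨fun ε hε => Tandem.exists_forall_relErr_le hlam hsum hstable hε,
    fun u x hu0 hx hu => ⟨?_, ?_, Tandem.le_liminf_relErr hlam hsum hstable hu0 hx hu⟩⟩
  · have h0 := Tandem.rho_pos hlam hstable
    have h1 := Tandem.rho_lt_one hlam hstable
    exact mul_pos (neg_pos.2 (Real.log_neg h0 h1))
      (sub_pos.2 (Tandem.g_lt_one hlam hstable hx))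
  · obtain ⟨n₀, -, hn₀⟩ := Tandem.exists_forall_relErr_le hlam hsum hstable one_pos
    filter_upwards [eventually_gt_atTop n₀, Tandem.eventually_mem_Rbar hu0 hx hu] with n hn hmem
    exact (hn₀ n hn _ hmem).1
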